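/- **Setting.** Fix a real $\rho\neq 0$. Points are the points of the real projective plane $\mathcal P=(\mathbb R^3\setminus\{0\})/\mathbb R^\times$. Put $\mathfrak S=\mathrm{diag}(\rho,1,1)$ and $\langle x,y\rangle=\rho x_1y_1+x_2y_2+x_3y_3$ (elliptic plane if $\rho>0$, extended hyperbolic plane if $\rho<0$). A point is isotropic if $\langle p,p\rangle=0$; for $\rho<0$ the isotropic points form the absolute conic, and the points with $\langle p,p\rangle<0$ lie inside it. The dual line of a point $m$ is $\{x:\langle m,x\rangle=0\}$; a line is anisotropic if its dual point is. Each point $P$ has a lexicographically positive representative $\hat P\in\mathbb R^3$, unique up to a positive factor; for anisotropic $P$ let $P^\circ$ be the one with $|\langle P^\circ,P^\circ\rangle|=1$. For vectors $p,q$ the segment joining them consists of the points represented by $sp+tq$, $s,t\ge 0$, not both $0$; for $p=\hat P,\ q=\hat Q$ it is denoted $[P,Q]_+$. Let $A,B,C$ be non-collinear anisotropic points with anisotropic sidelines $a=B\vee C$, $b=C\vee A$, $c=A\vee B$, such that the scalar squares of $A,B,C$ have the same sign, and those of the dual points of $a,b,c$ have the same sign. Let $(d_{ij})$ be the inverse of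 the Gram matrix of $A^\circ,B^\circ,C^\circ$. In coordinates with respect to the basis $A^\circ,B^\circ,C^\circ$ define the incenter $I_0=[\sqrt{|d_{11}|}:\sqrt{|d_{22}|}:\sqrt{|d_{33}|}]$, the circumcenter $O=[\sum_j d_{1j}:\sum_j d_{2j}:\sum_j d_{3j}]$ and the symmedian $K=[d_{11}:d_{22}:d_{33}]$. **Circles.** A circle with center $m$ is a conic $x^{T}Mx=0$ with $M$ real symmetric and indefinite, not proportional to $\mathfrak S$, such that the polar of every point of the dual line of $m$ is the dual line of that point. (Two isotropic lines meeting at $m$ are admitted as a degenerate circle.) Points lie on one branch of the circle if, for $m$ with a suitable sign, $\langle m,\hat P\rangle\ge 0$ for all these points $P$; that is, the segments $[P,Q]_+$ between them do not cross the dual line of $m$. **Antiparallel lines.** For lines $g,h$ such that $b,c,g,h$ are four different lines, $g$ is antiparallel to $h$ with respect to $\angle_+BAC$ if either $g\wedge h=A$ and $h$ is the mirror image of $g$ in the bisector $A\vee I_0$, or the following holds. Among $R_1=b\wedge g$, $R_2=g\wedge c$, $R_3=c\wedge h$, $R_4=h\wedge b$ there are at least three different points, and the segments $[R_1,R_2]_+,[R_2,R_3]_+,[R_3,R_4]_+,[R_4,R_1]_+$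 are cords of one branch of a circle. This means that $R_1,\dots,R_4$ lie on one branch of that circle; that, if two consecutive points coincide, the corresponding line $g$, $c$, $h$ or $b$ is tangent to the circle there; and that, if the plane is elliptic or $A$ lies inside the absolute conic, the inner points of the segments lie inside the circle (on no tangent). **Parallel lines.** $g$ is parallel to $h$ with respect to $\angle_+BAC$ if $g$ is antiparallel to the mirror image $h^*$ of $h$ in $A\vee I_0$. Here the points in which $h^*$ meets $c$ and $b$ are represented by the mirror images (under the linear reflection of $\mathbb R^3$ that fixes $A\vee I_0$ pointwise) of the vectors $\hat R$, where $R$ is $h\wedge b$ and $h\wedge c$, respectively, and the branch condition and the segments are formed with these representatives. The same notions are used for the angles at $B$ and $C$. **Theorem.** Let $P_1,Q_1$ be points on $a$, $P_2,Q_2$ points on $b$, $P_3,Q_3$ points on $c$, none of them a vertex and not all six of them isotropic, such that - $P_1\vee Q_2$ is parallel to $c$ with respect to the angle at $C$, - $Q_2\vee P_3$ is antiparallel to $a$ with respect to the angle at $A$, - $P_3\vee Q_1$ is parallel to $b$ with respect to the angle at $B$, - $Q_1\vee P_2$ is antiparallel to $c$ with respect to the angle at $C$, - $P_2\vee Q_3$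 is parallel to $a$ with respect to the angle at $A$. Then $Q_3\vee P_1$ is antiparallel to $b$ with respect to the angle at $B$. The six points lie on one branch of a circle (a Tucker circle). If $O\neq K$, the center of every circle that has the six points on one branch lies on the line $O\vee K$. -/

import Mathlib

open scoped LinearAlgebra.Projectivization Matrix

namespace CayleyKlein

/-- The real projective plane. A point is represented by nonzero vectors of `ℝ³`. -/
abbrev Plane := ℙ ℝ (Fin 3 → ℝ)

/-- A line is represented by the linear subspace of `ℝ³` spanned by its points. -/
abbrev Line := Submodule ℝ (Fin 3 → ℝ)

/-- The matrix `diag(ρ, 1, 1)`, which defines the metric structure on the plane: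
elliptic for `ρ > 0`, (extended) hyperbolic for `ρ < 0`. -/
def metricMatrix (ρ : ℝ) : Matrix (Fin 3) (Fin 3) ℝ := Matrix.diagonal ![ρ, 1, 1]

/-- The scalar product `ρ x₁ y₁ + x₂ y₂ + x₃ y₃`. -/
def form (ρ : ℝ) (x y : Fin 3 → ℝ) : ℝ := x ⬝ᵥ (metricMatrix ρ *ᵥ y)

/-- A vector that represents the dual point of the line with equation `l · x = 0`. -/
def dualVec (ρ : ℝ) (l : Fin 3 → ℝ) : Fin 3 → ℝ := ![l 0, ρ * l 1, ρ * l 2]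

open Classical in
/-- The sign of a vector with respect to the lexicographic order. -/
noncomputable def lexSign (x : Fin 3 → ℝ) : ℝ :=
  if x = 0 then 0
  else if 0 < x 0 ∨ (x 0 = 0 ∧ (0 < x 1 ∨ (x 1 = 0 ∧ 0 < x 2))) then 1
  else -1

/-- The lexicographically positive representative of a point, well defined up to a positive
factor. The segment `[P, Q]₊` consists of the points represented by
`s • lift P + t • lift Q` with `s, t ≥ 0`. -/
noncomputable def lift (P : Plane) : Fin 3 → ℝ := lexSign P.rep • P.rep

/-- The normalized representative `P°` of an anisotropic point `P`. -/
noncomputable def unitVec (ρ : ℝ) (P : Plane) : Fin 3 → ℝ :=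
  (lexSign P.rep / √|form ρ P.rep P.rep|) • P.rep

/-- Incidence of points and lines. -/
def OnLine (P : Plane) (l : Line) : Prop := P.rep ∈ l

/-- The line `P ∨ Q` through two different points. -/
noncomputable def join (P Q : Plane) : Line := Submodule.span ℝ {P.rep, Q.rep}

/-- The sign of the scalar square of the point `P`; it is `0` iff `P` is isotropic. -/
noncomputable def pointSign (ρ : ℝ) (P : Plane) : SignType :=
  SignType.sign (form ρ P.rep P.rep)

/-- The sign of the scalar square of the dual point of `P ∨ Q`;
it is `0` iff the line `P ∨ Q` is isotropic. -/
noncomputable def joinSign (ρ : ℝ) (P Q : Plane) : SignType :=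
  SignType.sign (form ρ (dualVec ρ (crossProduct P.rep Q.rep))
    (dualVec ρ (crossProduct P.rep Q.rep)))

/-- A non-collinear triple with anisotropic vertices and anisotropic sidelines, such that the
scalar squares of the three vertices have the same sign, and so have those of the dual points
of the three sidelines. -/
structure IsClassicalTriple (ρ : ℝ) (A B C : Plane) : Prop where
  independent : Projectivization.Independent ![A, B, C]
  vertex_ne : pointSign ρ A ≠ 0
  vertex_AB : pointSign ρ A = pointSign ρ B
  vertex_BC : pointSign ρ B = pointSign ρ C
  side_ne : joinSign ρ B C ≠ 0
  side_ab : joinSign ρ B C = joinSign ρ C A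
  side_bc : joinSign ρ C A = joinSign ρ A B

/-- The vectors `A°, B°, C°`. -/
noncomputable def frame (ρ : ℝ) (A B C : Plane) : Fin 3 → Fin 3 → ℝ :=
  ![unitVec ρ A, unitVec ρ B, unitVec ρ C]

/-- The inverse of the Gram matrix of `A°, B°, C°`. -/
noncomputable def dualGram (ρ : ℝ) (A B C : Plane) : Matrix (Fin 3) (Fin 3) ℝ :=
  (Matrix.of fun i j => form ρ (frame ρ A B C i) (frame ρ A B C j))⁻¹

/-- The incenter `I₀`, with barycentric coordinates `√|d₁₁| : √|d₂₂| : √|d₃₃|`. -/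
noncomputable def incenter (ρ : ℝ) (A B C : Plane) : Fin 3 → ℝ :=
  ∑ i, √|dualGram ρ A B C i i| • frame ρ A B C i

/-- The circumcenter `O`, whose barycentric coordinates are the row sums of `(dᵢⱼ)`. -/
noncomputable def circumcenter (ρ : ℝ) (A B C : Plane) : Fin 3 → ℝ :=
  ∑ i, (∑ j, dualGram ρ A B C i j) • frame ρ A B C i

/-- The symmedian `K`, with barycentric coordinates `d₁₁ : d₂₂ : d₃₃`. -/
noncomputable def symmedian (ρ : ℝ) (A B C : Plane) : Fin 3 → ℝ :=
  ∑ i, dualGram ρ A B C i i • frame ρ A B C i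

/-- The reflection in the point represented by `n`; equivalently, in the dual line of it. -/
noncomputable def reflection (ρ : ℝ) (n : Fin 3 → ℝ) : (Fin 3 → ℝ) →ₗ[ℝ] (Fin 3 → ℝ) where
  toFun x := x - (2 * form ρ n x / form ρ n n) • n
  map_add' x y := by
    simp only [form, Matrix.mulVec_add, dotProduct_add, mul_add, add_div, add_smul]
    abel
  map_smul' r x := by
    simp only [form, Matrix.mulVec_smul, dotProduct_smul, smul_eq_mul, RingHom.id_apply,
      smul_sub, smul_smul]
    congr 2
    ring

/-- The reflection in the bisector `A ∨ I₀` of the angle `∠₊ BAC`. -/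
noncomputable def mirror (ρ : ℝ) (A B C : Plane) : (Fin 3 → ℝ) →ₗ[ℝ] (Fin 3 → ℝ) :=
  reflection ρ (dualVec ρ (crossProduct (unitVec ρ A) (incenter ρ A B C)))

/-- The conic `xᵀ M x = 0` is a circle with center `m`: it is a real conic, it is not the
absolute conic, and all points of the dual line of `m` are symmetry points of it, that is, the
polar of such a point with respect to the conic is its dual line. Nondegeneracy is not required;
a degenerate conic that satisfies these conditions consists of two isotropic lines
that meet at `m`. -/
structure IsCircle (ρ : ℝ) (M : Matrix (Fin 3) (Fin 3) ℝ) (m : Fin 3 → ℝ) : Prop where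
  symm : M.IsSymm
  pos : ∃ x, 0 < x ⬝ᵥ (M *ᵥ x)
  neg : ∃ x, x ⬝ᵥ (M *ᵥ x) < 0
  not_absolute : ∀ r : ℝ, M ≠ r • metricMatrix ρ
  center_ne : m ≠ 0
  axis : ∀ x, form ρ m x = 0 → ∃ r : ℝ, M *ᵥ x = r • (metricMatrix ρ *ᵥ x)

/-- The point represented by `x` lies inside the conic `yᵀ M y = 0`: it lies on no tangent. -/
def Inside (M : Matrix (Fin 3) (Fin 3) ℝ) (x : Fin 3 → ℝ) : Prop :=
  ∀ y, y ≠ 0 → y ⬝ᵥ (M *ᵥ y) = 0 → x ⬝ᵥ (M *ᵥ y) ≠ 0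

/-- The four segments that join consecutive points of the closed chain `p 0, p 1, p 2, p 3` are
cords of one branch of the circle `M` with center `m`; here `p i` and `p (i + 1)` lie on `l i`,
and the segment between them is represented by `s • p i + t • p (i + 1)`, `s, t ≥ 0`.
* The points are on the circle, and no segment crosses the dual line of the center.
* If `p i` and `p (i + 1)` represent the same point, then `l i` is the tangent there.
* If `inner` holds, then the inner points of the segments lie inside the circle. -/
structure AreCords (ρ : ℝ) (inner : Prop) (M : Matrix (Fin 3) (Fin 3) ℝ) (m : Fin 3 → ℝ)
    (l : Fin 4 → Line) (p : Fin 4 → Fin 3 → ℝ) : Prop where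
  circle : IsCircle ρ M m
  mem : ∀ i, p i ⬝ᵥ (M *ᵥ p i) = 0
  branch : ∀ i, 0 ≤ form ρ m (p i)
  tangent : ∀ i, Submodule.span ℝ {p i} = Submodule.span ℝ {p (i + 1)} →
    ∀ x ∈ l i, x ⬝ᵥ (M *ᵥ p i) = 0
  inside : inner → ∀ i, Submodule.span ℝ {p i} ≠ Submodule.span ℝ {p (i + 1)} →
    ∀ s t : ℝ, 0 < s → 0 < t → Inside M (s • p i + t • p (i + 1))

/-- The points `p 0 = b ∧ g`, `p 1 = g ∧ c`, `p 2 = c ∧ h`, `p 3 = h ∧ b`, at least three of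
which are different, are joined by cords of a circle. -/
def CordCondition (ρ : ℝ) (inner : Prop) (b c g h : Line) (p : Fin 4 → Fin 3 → ℝ) : Prop :=
  (p 0 ∈ b ∧ p 0 ∈ g) ∧ (p 1 ∈ g ∧ p 1 ∈ c) ∧ (p 2 ∈ c ∧ p 2 ∈ h) ∧ (p 3 ∈ h ∧ p 3 ∈ b) ∧
  3 ≤ (Set.range fun i => Submodule.span ℝ {p i}).ncard ∧
  ∃ M m, AreCords ρ inner M m ![g, c, h, b] p

/-- The plane is elliptic, or `A` lies inside the absolute conic. -/
def IsOrdinary (ρ : ℝ) (A : Plane) : Prop := 0 < ρ ∨ form ρ A.rep A.rep < 0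

/-- The line `g` is antiparallel to the line `h` with respect to `∠₊ BAC`. -/
def Antiparallel (ρ : ℝ) (A B C : Plane) (g h : Line) : Prop :=
  ({join C A, join A B, g, h} : Set Line).ncard = 4 ∧
  ((OnLine A g ∧ OnLine A h ∧ h = g.map (mirror ρ A B C)) ∨
    ∃ P : Fin 4 → Plane,
      CordCondition ρ (IsOrdinary ρ A) (join C A) (join A B) g h fun i => lift (P i))

/-- The line `g` is parallel to the line `h` with respect to `∠₊ BAC`: it is antiparallel to the
mirror image of `h` in the angle bisector. The points where the mirror image of `h` meets the
legs, and the segments between them, are taken as mirror images of points of `h`. -/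
def Parallel (ρ : ℝ) (A B C : Plane) (g h : Line) : Prop :=
  ({join C A, join A B, g, h.map (mirror ρ A B C)} : Set Line).ncard = 4 ∧
  ((OnLine A g ∧ OnLine A h ∧ h = g) ∨
    ∃ P : Fin 4 → Plane,
      CordCondition ρ (IsOrdinary ρ A) (join C A) (join A B) g (h.map (mirror ρ A B C))
        ![lift (P 0), lift (P 1), mirror ρ A B C (lift (P 2)), mirror ρ A B C (lift (P 3))])

/-- The points of `s` lie on one branch of the circle `M` with center `m`, that is, the segments
`[P, Q]₊` with ends in `s` do not cross the dual line of the center. -/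
structure OnCircle (ρ : ℝ) (M : Matrix (Fin 3) (Fin 3) ℝ) (m : Fin 3 → ℝ) (s : Set Plane) :
    Prop where
  circle : IsCircle ρ M m
  mem : ∀ P ∈ s, lift P ⬝ᵥ (M *ᵥ lift P) = 0
  branch : ∀ P ∈ s, 0 ≤ form ρ m (lift P)

end CayleyKlein

namespace CayleyKlein

variable {ρ ε : ℝ}

/-! Let `ε` be the common sign of the scalar squares of the vertices. A circle through a point of
sign `ε` has, after rescaling its center by a positive factor, the equation `ε⟨x,x⟩ = ⟨m,x⟩²`
(`IsCircle.exists_form_eq_of_mem`). Lying on one branch then means `⟨m,p⟩ = √(ε⟨p,p⟩)`: a linear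
functional agrees with the norm at `p`. Incidence with a branch thus becomes linear.

For an antiparallel to `BC` at `A`, the functional is `1` at `B°` and `C°`, so its only unknown is
its value `φ` at `A°`. Each of the two points on the legs determines `φ`, and the lines are
antiparallel iff both give the same `φ` (`Antiparallel.exists_isCut`, `antiparallel_of_isCut`). For
a parallel, the functional is `1` at the mirror images of `B°` and `C°`. Rewritten with the value
`1` at `A°`, its restrictions to the two legs have values at `C°` and `B°` whose differences from
`1` are in a fixed ratio (`Parallel.exists_isCut`).

Put `s = 1 - ε⟨·,·⟩` for the end vectors of each side. One parameter `λ` then runs through the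
hexagon: the value attached to a vertex is `1 - λ` times the product of the `s` of the two sides
through it. Five conditions transport `λ` around the hexagon, and the first and last cuts carry the
same value at `B`, which is the sixth condition.

With `μ = 2 - λ²s₁s₂s₃`, the functional whose value at each vertex is `(2 + λ²s₁s₂s₃ - 2λ·(product
of the two adjacent s))/μ` agrees with the norm at all six points (`IsCut.on_circle`), and `μ = 0`
would make all six isotropic (`isotropic_of_isCut`). Its center is a combination of `O` and the
vector `W` dual to `(s₂s₃, s₁s₃, s₁s₂)`. Since `K` is one too, with nonzero `W`-coefficient when `O
≠ K`, the center lies on `O ∨ K` (`NormalFrame.vecOfDual_mem_span`). No nonzero functional vanishes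
at all six points (`hexagon_nondegenerate`), so every other circle through them on one branch has
the same center. -/

theorem form_apply (ρ : ℝ) (x y : Fin 3 → ℝ) :
    form ρ x y = ρ * x 0 * y 0 + x 1 * y 1 + x 2 * y 2 := by
  simp [form, metricMatrix, dotProduct, Fin.sum_univ_three, Matrix.mulVec_diagonal]
  ring

theorem form_comm (ρ : ℝ) (x y : Fin 3 → ℝ) : form ρ x y = form ρ y x := by
  simp only [form_apply]; ring

theorem form_add_left (x y z : Fin 3 → ℝ) : form ρ (x + y) z = form ρ x z + form ρ y z := by
  simp only [form_apply, Pi.add_apply]; ring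

theorem form_add_right (x y z : Fin 3 → ℝ) : form ρ x (y + z) = form ρ x y + form ρ x z := by
  simp only [form_apply, Pi.add_apply]; ring

theorem form_sub_left (x y z : Fin 3 → ℝ) : form ρ (x - y) z = form ρ x z - form ρ y z := by
  simp only [form_apply, Pi.sub_apply]; ring

theorem form_sub_right (x y z : Fin 3 → ℝ) : form ρ x (y - z) = form ρ x y - form ρ x z := by
  simp only [form_apply, Pi.sub_apply]; ring

theorem form_smul_left (r : ℝ) (x y : Fin 3 → ℝ) : form ρ (r • x) y = r * form ρ x y := by
  simp only [form_apply, Pi.smul_apply, smul_eq_mul]; ring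

theorem form_smul_right (r : ℝ) (x y : Fin 3 → ℝ) : form ρ x (r • y) = r * form ρ x y := by
  simp only [form_apply, Pi.smul_apply, smul_eq_mul]; ring

theorem form_zero_left (x : Fin 3 → ℝ) : form ρ 0 x = 0 := by
  simp [form_apply]

theorem form_dualVec (l x : Fin 3 → ℝ) : form ρ (dualVec ρ l) x = ρ * (l ⬝ᵥ x) := by
  simp [form_apply, dualVec, dotProduct, Fin.sum_univ_three]; ring

theorem eq_zero_of_form_eq_zero (hρ : ρ ≠ 0) {x : Fin 3 → ℝ} (h : ∀ y, form ρ x y = 0) :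
    x = 0 := by
  ext i
  have h0 := h (Pi.single i 1)
  fin_cases i <;> simpa [form_apply, hρ] using h0

theorem metricMatrix_mulVec_injective (hρ : ρ ≠ 0) {x : Fin 3 → ℝ}
    (h : metricMatrix ρ *ᵥ x = 0) : x = 0 := by
  refine eq_zero_of_form_eq_zero hρ fun y => ?_
  rw [form_comm, form, h, dotProduct_zero]

/-- Lagrange's identity for the form. The factor `ρ` is common to the three sides, so equal signs of
the sides mean equal signs of the Gram determinants of the vertex pairs. -/
theorem form_gram (x y : Fin 3 → ℝ) :
    form ρ (dualVec ρ (crossProduct x y)) (dualVec ρ (crossProduct x y)) =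
      ρ * (form ρ x x * form ρ y y - form ρ x y ^ 2) := by
  simp [form_apply, dualVec, cross_apply]; ring

/-! ### Representatives of points -/

theorem lexSign_mul_self {x : Fin 3 → ℝ} (h : x ≠ 0) : lexSign x * lexSign x = 1 := by
  unfold lexSign
  split_ifs <;> simp_all

theorem lexSign_rep_ne_zero (P : Plane) : lexSign P.rep ≠ 0 := by
  intro h
  have := lexSign_mul_self P.rep_nonzero
  simp [h] at this

theorem lift_ne_zero (P : Plane) : lift P ≠ 0 :=
  smul_ne_zero (lexSign_rep_ne_zero P) P.rep_nonzero

theorem form_lift (P : Plane) : form ρ (lift P) (lift P) = form ρ P.rep P.rep := by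
  rw [lift, form_smul_left, form_smul_right, ← mul_assoc, lexSign_mul_self P.rep_nonzero, one_mul]

theorem eq_of_lift_eq_smul {P Q : Plane} {r : ℝ} (h : lift P = r • lift Q) : P = Q := by
  rw [← P.mk_rep, ← Q.mk_rep, Projectivization.mk_eq_mk_iff']
  refine ⟨(lexSign P.rep)⁻¹ * (r * lexSign Q.rep), ?_⟩
  rw [lift, lift] at h
  rw [mul_smul, mul_smul, ← h, inv_smul_smul₀ (lexSign_rep_ne_zero P)]

/-- If the first coordinate vanished, the form would be a sum of two squares and positive; so the
lexicographic sign is the sign of the first coordinate. -/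
theorem lift_pos_of_form_nonpos (P : Plane) (h : form ρ (lift P) (lift P) ≤ 0) :
    0 < lift P 0 := by
  have h0 : P.rep 0 ≠ 0 := by
    intro h0
    rw [form_lift, form_apply, h0] at h
    refine P.rep_nonzero ?_
    ext i
    have h1 : P.rep 1 = 0 := by nlinarith [mul_self_nonneg (P.rep 1), mul_self_nonneg (P.rep 2)]
    have h2 : P.rep 2 = 0 := by nlinarith [mul_self_nonneg (P.rep 1), mul_self_nonneg (P.rep 2)]
    fin_cases i <;> simp [h0, h1, h2]
  simp only [lift, lexSign, if_neg P.rep_nonzero, h0, false_and, or_false, Pi.smul_apply,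
    smul_eq_mul]
  split_ifs with h1
  · simpa using h1
  · have := lt_of_le_of_ne (not_lt.1 h1) h0
    linarith

/-- A point is anisotropic if its scalar square does not vanish. -/
def IsAnisotropic (ρ : ℝ) (P : Plane) : Prop := form ρ P.rep P.rep ≠ 0

theorem unitVec_eq (P : Plane) :
    unitVec ρ P = (√|form ρ P.rep P.rep|)⁻¹ • lift P := by
  rw [unitVec, lift, smul_smul, div_eq_inv_mul]

theorem lift_eq {P : Plane} (h : IsAnisotropic ρ P) :
    ∃ r : ℝ, 0 < r ∧ lift P = r • unitVec ρ P := by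
  have : 0 < √|form ρ P.rep P.rep| := Real.sqrt_pos.2 (abs_pos.2 h)
  exact ⟨_, this, by rw [unitVec_eq, smul_inv_smul₀ this.ne']⟩

theorem rep_eq {P : Plane} (h : IsAnisotropic ρ P) :
    ∃ r : ℝ, r ≠ 0 ∧ P.rep = r • unitVec ρ P := by
  obtain ⟨r, hr, h⟩ := lift_eq h
  refine ⟨(lexSign P.rep)⁻¹ * r, mul_ne_zero (inv_ne_zero (lexSign_rep_ne_zero P)) hr.ne', ?_⟩
  rw [mul_smul, ← h, lift, inv_smul_smul₀ (lexSign_rep_ne_zero P)]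

theorem form_unitVec (P : Plane) :
    form ρ (unitVec ρ P) (unitVec ρ P) = form ρ P.rep P.rep / |form ρ P.rep P.rep| := by
  rw [unitVec_eq, form_smul_left, form_smul_right, form_lift, ← mul_assoc, ← mul_inv,
    Real.mul_self_sqrt (abs_nonneg _), inv_mul_eq_div]

theorem span_pair_smul {V : Type*} [AddCommGroup V] [Module ℝ V] {r s : ℝ} (hr : r ≠ 0)
    (hs : s ≠ 0) (x y : V) :
    Submodule.span ℝ {r • x, s • y} = Submodule.span ℝ {x, y} := by
  rw [Submodule.span_insert, Submodule.span_insert, Submodule.span_singleton_smul_eq hr.isUnit,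
    Submodule.span_singleton_smul_eq hs.isUnit]

theorem join_eq_lift (P Q : Plane) : join P Q = Submodule.span ℝ {lift P, lift Q} := by
  rw [lift, lift, span_pair_smul (lexSign_rep_ne_zero P) (lexSign_rep_ne_zero Q), join]

theorem join_eq {P Q : Plane} (hP : IsAnisotropic ρ P) (hQ : IsAnisotropic ρ Q) :
    join P Q = Submodule.span ℝ {unitVec ρ P, unitVec ρ Q} := by
  obtain ⟨r, hr, h⟩ := rep_eq hP
  obtain ⟨s, hs, h'⟩ := rep_eq hQ
  rw [join, h, h', span_pair_smul hr hs]

theorem onLine_iff {P : Plane} {l : Line} : OnLine P l ↔ lift P ∈ l :=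
  (Submodule.smul_mem_iff l (lexSign_rep_ne_zero P)).symm

/-- Coordinates of a point on a line with respect to two anisotropic points of that line. -/
theorem exists_lift_eq {A B P : Plane} (hA : IsAnisotropic ρ A) (hB : IsAnisotropic ρ B)
    (h : OnLine P (join A B)) (hPA : P ≠ A) (hPB : P ≠ B) :
    ∃ u v : ℝ, u ≠ 0 ∧ v ≠ 0 ∧ lift P = u • unitVec ρ A + v • unitVec ρ B := by
  rw [onLine_iff, join_eq hA hB, Submodule.mem_span_pair] at h
  obtain ⟨u, v, h⟩ := h
  refine ⟨u, v, ?_, ?_, h.symm⟩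
  · rintro rfl
    rw [unitVec_eq B, zero_smul, zero_add, smul_smul] at h
    exact hPB (eq_of_lift_eq_smul h.symm)
  · rintro rfl
    rw [unitVec_eq A, zero_smul, add_zero, smul_smul] at h
    exact hPA (eq_of_lift_eq_smul h.symm)

/-! ### Normalized frames -/

/-- A basis of vectors with the same scalar square `ε = ±1` such that the Gram determinants of
the pairs of basis vectors have the same sign. -/
structure NormalFrame (ρ ε : ℝ) (a b c : Fin 3 → ℝ) : Prop where
  metric_ne : ρ ≠ 0
  sq : ε * ε = 1
  aa : ε * form ρ a a = 1
  bb : ε * form ρ b b = 1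
  cc : ε * form ρ c c = 1
  vol : a ⬝ᵥ b ⨯₃ c ≠ 0
  bc_ca : 0 < (1 - (ε * form ρ b c) ^ 2) * (1 - (ε * form ρ c a) ^ 2)
  ca_ab : 0 < (1 - (ε * form ρ c a) ^ 2) * (1 - (ε * form ρ a b) ^ 2)

namespace NormalFrame

variable {a b c : Fin 3 → ℝ}

theorem ab_bc (h : NormalFrame ρ ε a b c) :
    0 < (1 - (ε * form ρ a b) ^ 2) * (1 - (ε * form ρ b c) ^ 2) := by
  have h1 := h.bc_ca
  have h2 := h.ca_ab
  generalize 1 - (ε * form ρ a b) ^ 2 = x at *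
  generalize 1 - (ε * form ρ b c) ^ 2 = y at *
  generalize 1 - (ε * form ρ c a) ^ 2 = z at *
  have h3 : 0 < (x * y) * z ^ 2 := by nlinarith [mul_pos h1 h2]
  exact pos_of_mul_pos_left h3 (sq_nonneg z)

theorem rotate (h : NormalFrame ρ ε a b c) : NormalFrame ρ ε b c a where
  metric_ne := h.metric_ne
  sq := h.sq
  aa := h.bb
  bb := h.cc
  cc := h.aa
  vol := by rw [← triple_product_permutation]; exact h.vol
  bc_ca := h.ca_ab
  ca_ab := h.ab_bc

theorem swap (h : NormalFrame ρ ε a b c) : NormalFrame ρ ε a c b where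
  metric_ne := h.metric_ne
  sq := h.sq
  aa := h.aa
  bb := h.cc
  cc := h.bb
  vol := by rw [← cross_anticomm, dotProduct_neg, neg_ne_zero]; exact h.vol
  bc_ca := by rw [form_comm ρ c b, form_comm ρ b a, mul_comm]; exact h.ab_bc
  ca_ab := by rw [form_comm ρ b a, form_comm ρ a c, mul_comm]; exact h.ca_ab

theorem bc_ne (h : NormalFrame ρ ε a b c) : 1 - (ε * form ρ b c) ^ 2 ≠ 0 :=
  left_ne_zero_of_mul h.bc_ca.ne'

theorem ca_ne (h : NormalFrame ρ ε a b c) : 1 - (ε * form ρ c a) ^ 2 ≠ 0 :=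
  left_ne_zero_of_mul h.ca_ab.ne'

theorem ab_ne (h : NormalFrame ρ ε a b c) : 1 - (ε * form ρ a b) ^ 2 ≠ 0 :=
  left_ne_zero_of_mul h.ab_bc.ne'

theorem linearIndependent (h : NormalFrame ρ ε a b c) : LinearIndependent ℝ ![a, b, c] := by
  have h1 := h.vol
  rw [triple_product_eq_det] at h1
  exact Matrix.linearIndependent_rows_iff_isUnit.2
    ((Matrix.isUnit_iff_isUnit_det _).2 (isUnit_iff_ne_zero.2 h1))

theorem coord_eq_zero (h : NormalFrame ρ ε a b c) {u v w : ℝ}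
    (h0 : u • a + v • b + w • c = 0) : u = 0 ∧ v = 0 ∧ w = 0 := by
  have h1 := Fintype.linearIndependent_iff.1 h.linearIndependent ![u, v, w]
    (by simpa [Fin.sum_univ_three] using h0)
  exact ⟨h1 0, h1 1, h1 2⟩

theorem exists_coord (h : NormalFrame ρ ε a b c) (x : Fin 3 → ℝ) :
    ∃ u v w : ℝ, x = u • a + v • b + w • c := by
  have h1 : Submodule.span ℝ (Set.range ![a, b, c]) = ⊤ :=
    h.linearIndependent.span_eq_top_of_card_eq_finrank (by simp)
  have h2 : x ∈ Submodule.span ℝ (Set.range ![a, b, c]) := h1 ▸ Submodule.mem_top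
  obtain ⟨f, rfl⟩ := (Submodule.mem_span_range_iff_exists_fun ℝ).1 h2
  exact ⟨f 0, f 1, f 2, by simp [Fin.sum_univ_three]⟩

theorem eq_of_form_eq (h : NormalFrame ρ ε a b c) {x y : Fin 3 → ℝ}
    (ha : form ρ x a = form ρ y a) (hb : form ρ x b = form ρ y b)
    (hc : form ρ x c = form ρ y c) : x = y := by
  rw [← sub_eq_zero]
  refine eq_zero_of_form_eq_zero h.metric_ne fun z => ?_
  obtain ⟨u, v, w, rfl⟩ := h.exists_coord z
  simp [form_add_right, form_smul_right, form_sub_left, ha, hb, hc]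

theorem pair_coord (h : NormalFrame ρ ε a b c) {u v u' v' : ℝ}
    (h0 : u • a + v • b = u' • a + v' • b) : u = u' ∧ v = v' := by
  have := h.coord_eq_zero (u := u - u') (v := v - v') (w := 0) (by
    rw [zero_smul, add_zero, sub_smul, sub_smul, sub_add_sub_comm, h0, sub_self])
  exact ⟨sub_eq_zero.1 this.1, sub_eq_zero.1 this.2.1⟩

end NormalFrame

/-! ### Reflections -/

theorem reflection_apply (n x : Fin 3 → ℝ) :
    reflection ρ n x = x - (2 * form ρ n x / form ρ n n) • n := rfl

theorem reflection_smul {r : ℝ} (hr : r ≠ 0) (n x : Fin 3 → ℝ) :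
    reflection ρ (r • n) x = reflection ρ n x := by
  simp only [reflection_apply, form_smul_left, form_smul_right, smul_smul]
  congr 2
  rcases eq_or_ne (form ρ n n) 0 with h | h
  · simp [h]
  · field_simp

theorem form_reflection (n x y : Fin 3 → ℝ) :
    form ρ (reflection ρ n x) (reflection ρ n y) = form ρ x y := by
  simp only [reflection_apply, form_sub_left, form_sub_right, form_smul_left, form_smul_right]
  rcases eq_or_ne (form ρ n n) 0 with h | h
  · simp [h]
  · rw [form_comm ρ x n]
    field_simp
    ring

theorem reflection_reflection (n x : Fin 3 → ℝ) :
    reflection ρ n (reflection ρ n x) = x := by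
  simp only [reflection_apply, form_sub_right, form_smul_right]
  rcases eq_or_ne (form ρ n n) 0 with h | h
  · simp [h]
  · rw [sub_sub, ← add_smul, sub_eq_self]
    convert zero_smul ℝ n using 2
    field_simp
    ring

theorem reflection_eq_self {n x : Fin 3 → ℝ} (h : form ρ n x = 0) : reflection ρ n x = x := by
  simp [reflection_apply, h]

/-- The reflection in the bisector of an angle interchanges the legs. -/
theorem NormalFrame.reflection_eq {a b c n : Fin 3 → ℝ} (h : NormalFrame ρ ε a b c)
    {d₁ d₂ d₃ : ℝ} (h2 : d₂ ≠ 0) (h3 : d₃ ≠ 0)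
    (hd : d₃ ^ 2 * (1 - (ε * form ρ c a) ^ 2) = d₂ ^ 2 * (1 - (ε * form ρ a b) ^ 2))
    (hn : n ≠ 0) (hna : form ρ n a = 0) (hni : form ρ n (d₁ • a + d₂ • b + d₃ • c) = 0) :
    reflection ρ n b = (d₃ / d₂) • c + (ε * form ρ a b - d₃ / d₂ * (ε * form ρ c a)) • a := by
  obtain ⟨t, ht⟩ : ∃ t, t = d₃ / d₂ := ⟨_, rfl⟩
  have ht0 : t ≠ 0 := ht ▸ div_ne_zero h3 h2
  rw [← ht]
  have hd3 : d₃ = t * d₂ := by rw [ht]; field_simp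
  have hts : t ^ 2 * (1 - (ε * form ρ c a) ^ 2) = 1 - (ε * form ρ a b) ^ 2 := by
    rw [hd3] at hd
    have : d₂ ^ 2 ≠ 0 := pow_ne_zero 2 h2
    apply mul_left_cancel₀ this
    linarith
  -- The expected displacement of `b`. Both `w` and `n` are orthogonal to `a` and to `b + t • c`,
  -- hence proportional; and `⟨w,w⟩ = -2⟨w,b⟩` means that the reflection in `w` adds `w` to `b`.
  set w := t • c + (ε * form ρ a b - t * (ε * form ρ c a)) • a - b with hw
  have e2 : ε ^ 2 = 1 := by rw [pow_two]; exact h.sq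
  have haa : form ρ a a = ε := by linear_combination ε * h.aa - form ρ a a * e2
  have hbb : form ρ b b = ε := by linear_combination ε * h.bb - form ρ b b * e2
  have hcc : form ρ c c = ε := by linear_combination ε * h.cc - form ρ c c * e2
  have hwa : form ρ w a = 0 := by
    simp only [hw, form_sub_left, form_add_left, form_smul_left, haa, form_comm ρ b a]
    linear_combination (form ρ a b - t * form ρ c a) * e2
  have hwbc : form ρ w b + t * form ρ w c = 0 := by
    simp only [hw, form_sub_left, form_add_left, form_smul_left, hbb, hcc, form_comm ρ c b,
      form_comm ρ a c]
    linear_combination ε * hts + (ε * t ^ 2 * form ρ c a ^ 2 - ε * form ρ a b ^ 2) * e2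
  have hww : form ρ w w = -2 * form ρ w b := by
    have : form ρ w w = t * form ρ w c + (ε * form ρ a b - t * (ε * form ρ c a)) * form ρ w a
        - form ρ w b := by
      conv_lhs => rw [hw, form_sub_right, form_add_right, form_smul_right, form_smul_right]
    rw [this, hwa]
    linear_combination hwbc
  have hwb : form ρ w b ≠ 0 := by
    intro h0
    have hwc : form ρ w c = 0 := by
      rw [h0, zero_add] at hwbc
      exact (mul_eq_zero.1 hwbc).resolve_left ht0
    have hw0 : w = 0 := h.eq_of_form_eq (by rw [hwa, form_zero_left]) (by rw [h0, form_zero_left])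
      (by rw [hwc, form_zero_left])
    have := (h.coord_eq_zero (u := ε * form ρ a b - t * (ε * form ρ c a)) (v := -1) (w := t) (by
      rw [← hw0, hw, neg_one_smul]; abel)).2.1
    norm_num at this
  have hnbc : form ρ n b + t * form ρ n c = 0 := by
    simp only [form_add_right, form_smul_right, hna] at hni
    apply mul_left_cancel₀ h2
    rw [hd3] at hni
    linear_combination hni
  have hnw : n = (form ρ n b / form ρ w b) • w := by
    refine h.eq_of_form_eq ?_ ?_ ?_
    · rw [form_smul_left, hna, hwa, mul_zero]
    · rw [form_smul_left, div_mul_cancel₀ _ hwb]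
    · rw [form_smul_left]
      field_simp
      apply mul_left_cancel₀ ht0
      linear_combination form ρ w b * hnbc - form ρ n b * hwbc
  have hτ : form ρ n b / form ρ w b ≠ 0 := by
    intro h0
    rw [h0, zero_smul] at hnw
    exact hn hnw
  rw [hnw, reflection_smul hτ, reflection_apply, hww]
  have : 2 * form ρ w b / (-2 * form ρ w b) = -1 := by field_simp
  rw [this, neg_one_smul, sub_neg_eq_add, hw]
  abel

/-! ### Classical triples -/

theorem mul_pos_of_sign_eq {x y : ℝ} (h : SignType.sign x = SignType.sign y)
    (hx : SignType.sign x ≠ 0) : 0 < x * y := by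
  rw [← sign_eq_one_iff, sign_mul, ← h]
  revert hx
  generalize SignType.sign x = s
  revert s
  decide

theorem form_unitVec_eq_sign {P : Plane} (h : IsAnisotropic ρ P) :
    form ρ (unitVec ρ P) (unitVec ρ P) = (pointSign ρ P : ℝ) := by
  rw [form_unitVec, pointSign, div_eq_iff (abs_ne_zero.2 h), sign_mul_abs]

theorem joinSign_eq {P Q : Plane} (hP : IsAnisotropic ρ P) (hQ : IsAnisotropic ρ Q) :
    ∃ r : ℝ, 0 < r ∧ joinSign ρ P Q = SignType.sign (r * (ρ *
      (form ρ (unitVec ρ P) (unitVec ρ P) * form ρ (unitVec ρ Q) (unitVec ρ Q) -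
        form ρ (unitVec ρ P) (unitVec ρ Q) ^ 2))) := by
  obtain ⟨r, hr, h⟩ := rep_eq hP
  obtain ⟨s, hs, h'⟩ := rep_eq hQ
  refine ⟨(r * s) ^ 2, by positivity, ?_⟩
  rw [joinSign, form_gram, h, h']
  simp only [form_smul_left, form_smul_right]
  ring_nf

namespace IsClassicalTriple

variable {A B C : Plane}

theorem rotate (h : IsClassicalTriple ρ A B C) : IsClassicalTriple ρ B C A where
  independent := by
    have h1 := h.independent
    rw [Projectivization.independent_iff] at h1 ⊢
    have h2 : (Projectivization.rep ∘ ![B, C, A] : Fin 3 → Fin 3 → ℝ) =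
        (Projectivization.rep ∘ ![A, B, C]) ∘ ![1, 2, 0] := by
      ext i j; fin_cases i <;> rfl
    rw [h2]
    exact h1.comp ![1, 2, 0] (by decide)
  vertex_ne := h.vertex_AB ▸ h.vertex_ne
  vertex_AB := h.vertex_BC
  vertex_BC := (h.vertex_AB.trans h.vertex_BC).symm
  side_ne := h.side_ab ▸ h.side_ne
  side_ab := h.side_bc
  side_bc := (h.side_ab.trans h.side_bc).symm

theorem anisotropic (h : IsClassicalTriple ρ A B C) : IsAnisotropic ρ A := by
  have := h.vertex_ne
  rwa [pointSign, Ne, sign_eq_zero_iff] at this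

theorem normalFrame (hρ : ρ ≠ 0) (h : IsClassicalTriple ρ A B C) :
    NormalFrame ρ (pointSign ρ A) (unitVec ρ A) (unitVec ρ B) (unitVec ρ C) := by
  have hA := h.anisotropic
  have hB := h.rotate.anisotropic
  have hC := h.rotate.rotate.anisotropic
  obtain ⟨ε, hε⟩ : ∃ ε : ℝ, ε = pointSign ρ A := ⟨_, rfl⟩
  have e2 : ε * ε = 1 := by
    have := h.vertex_ne
    rw [hε]
    revert this
    generalize pointSign ρ A = s
    revert s
    rintro (_ | _ | _) <;> simp
  have haa : form ρ (unitVec ρ A) (unitVec ρ A) = ε := by rw [form_unitVec_eq_sign hA, hε]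
  have hbb : form ρ (unitVec ρ B) (unitVec ρ B) = ε := by
    rw [form_unitVec_eq_sign hB, hε, h.vertex_AB]
  have hcc : form ρ (unitVec ρ C) (unitVec ρ C) = ε := by
    rw [form_unitVec_eq_sign hC, hε, h.vertex_AB, h.vertex_BC]
  have key : ∀ {x y r s : ℝ}, 0 < r → 0 < s →
      0 < r * (ρ * (ε * ε - x ^ 2)) * (s * (ρ * (ε * ε - y ^ 2))) →
      0 < (1 - (ε * x) ^ 2) * (1 - (ε * y) ^ 2) := by
    intro x y r s hr hs h0
    have h1 : r * (ρ * (ε * ε - x ^ 2)) * (s * (ρ * (ε * ε - y ^ 2))) =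
        ((1 - (ε * x) ^ 2) * (1 - (ε * y) ^ 2)) * (r * s * ρ ^ 2) := by
      rw [mul_pow, mul_pow, pow_two ε, e2]; ring
    rw [h1] at h0
    exact pos_of_mul_pos_left h0 (by positivity)
  obtain ⟨r₁, hr₁, h₁⟩ := joinSign_eq hB hC
  obtain ⟨r₂, hr₂, h₂⟩ := joinSign_eq hC hA
  obtain ⟨r₃, hr₃, h₃⟩ := joinSign_eq hA hB
  have hs1 := h.side_ne
  have hs2 := h.rotate.side_ne
  have hs12 := h.side_ab
  have hs23 := h.side_bc
  rw [h₁, h₂, hbb, hcc, haa] at hs12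
  rw [h₂, h₃, hbb, hcc, haa] at hs23
  rw [h₁, hbb, hcc] at hs1
  rw [h₂, haa, hcc] at hs2
  rw [← hε]
  refine ⟨hρ, e2, by rw [haa, e2], by rw [hbb, e2], by rw [hcc, e2], ?_,
    key hr₁ hr₂ (mul_pos_of_sign_eq hs12 hs1), key hr₂ hr₃ (mul_pos_of_sign_eq hs23 hs2)⟩
  have h0 := Projectivization.independent_iff.1 h.independent
  obtain ⟨r, hr, ha⟩ := rep_eq hA
  obtain ⟨s, hs, hb⟩ := rep_eq hB
  obtain ⟨t, ht, hc⟩ := rep_eq hC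
  have h1 : (Projectivization.rep ∘ ![A, B, C] : Fin 3 → Fin 3 → ℝ) =
      ![A.rep, B.rep, C.rep] := by
    ext i j; fin_cases i <;> rfl
  rw [h1] at h0
  have h2 := (Matrix.isUnit_iff_isUnit_det _).1 (Matrix.linearIndependent_rows_iff_isUnit.1 h0)
  have h3 : A.rep ⬝ᵥ B.rep ⨯₃ C.rep ≠ 0 := by
    rw [triple_product_eq_det]
    exact h2.ne_zero
  intro h4
  apply h3
  rw [ha, hb, hc]
  simp [h4]

end IsClassicalTriple

/-! ### The dual Gram matrix -/

/-- The Gram matrix of the normalized representatives. -/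
noncomputable def gram (ρ : ℝ) (A B C : Plane) : Matrix (Fin 3) (Fin 3) ℝ :=
  Matrix.of fun i j => form ρ (frame ρ A B C i) (frame ρ A B C j)

theorem dualGram_eq (A B C : Plane) : dualGram ρ A B C = (gram ρ A B C)⁻¹ := rfl

theorem NormalFrame.det_gram_ne_zero {A B C : Plane}
    (h : NormalFrame ρ ε (unitVec ρ A) (unitVec ρ B) (unitVec ρ C)) :
    (gram ρ A B C).det ≠ 0 := by
  intro h0
  obtain ⟨v, hv, hv'⟩ := Matrix.exists_mulVec_eq_zero_iff.2 h0
  have h1 := congrFun hv'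
  have h2 : v 0 • unitVec ρ A + v 1 • unitVec ρ B + v 2 • unitVec ρ C = 0 := by
    refine h.eq_of_form_eq ?_ ?_ ?_
    · have := h1 0
      simp only [gram, Matrix.mulVec, dotProduct, Fin.sum_univ_three, frame, Matrix.of_apply,
        Matrix.cons_val, Pi.zero_apply] at this
      rw [form_zero_left, form_add_left, form_add_left, form_smul_left, form_smul_left,
        form_smul_left, form_comm ρ (unitVec ρ B) (unitVec ρ A),
        form_comm ρ (unitVec ρ C) (unitVec ρ A)]
      linarith
    · have := h1 1
      simp only [gram, Matrix.mulVec, dotProduct, Fin.sum_univ_three, frame, Matrix.of_apply,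
        Matrix.cons_val, Pi.zero_apply] at this
      rw [form_zero_left, form_add_left, form_add_left, form_smul_left, form_smul_left,
        form_smul_left, form_comm ρ (unitVec ρ A) (unitVec ρ B),
        form_comm ρ (unitVec ρ C) (unitVec ρ B)]
      linarith
    · have := h1 2
      simp only [gram, Matrix.mulVec, dotProduct, Fin.sum_univ_three, frame, Matrix.of_apply,
        Matrix.cons_val, Pi.zero_apply] at this
      rw [form_zero_left, form_add_left, form_add_left, form_smul_left, form_smul_left,
        form_smul_left, form_comm ρ (unitVec ρ A) (unitVec ρ C),
        form_comm ρ (unitVec ρ B) (unitVec ρ C)]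
      linarith
  obtain ⟨h3, h4, h5⟩ := h.coord_eq_zero h2
  exact hv (by ext i; fin_cases i <;> assumption)

theorem NormalFrame.dualGram_diag {A B C : Plane}
    (h : NormalFrame ρ ε (unitVec ρ A) (unitVec ρ B) (unitVec ρ C)) :
    ∃ δ : ℝ, δ ≠ 0 ∧
      dualGram ρ A B C 0 0 = δ * (1 - (ε * form ρ (unitVec ρ B) (unitVec ρ C)) ^ 2) ∧
      dualGram ρ A B C 1 1 = δ * (1 - (ε * form ρ (unitVec ρ C) (unitVec ρ A)) ^ 2) ∧
      dualGram ρ A B C 2 2 = δ * (1 - (ε * form ρ (unitVec ρ A) (unitVec ρ B)) ^ 2) := by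
  refine ⟨((gram ρ A B C).det)⁻¹, inv_ne_zero h.det_gram_ne_zero, ?_⟩
  have e2 : ε ^ 2 = 1 := by rw [pow_two]; exact h.sq
  have hAA : form ρ (unitVec ρ A) (unitVec ρ A) = ε := by
    linear_combination ε * h.aa - form ρ (unitVec ρ A) (unitVec ρ A) * e2
  have hBB : form ρ (unitVec ρ B) (unitVec ρ B) = ε := by
    linear_combination ε * h.bb - form ρ (unitVec ρ B) (unitVec ρ B) * e2
  have hCC : form ρ (unitVec ρ C) (unitVec ρ C) = ε := by
    linear_combination ε * h.cc - form ρ (unitVec ρ C) (unitVec ρ C) * e2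
  rw [dualGram_eq, Matrix.inv_def, Ring.inverse_eq_inv']
  generalize ((gram ρ A B C).det)⁻¹ = d
  have hG : gram ρ A B C =
      !![ε, form ρ (unitVec ρ A) (unitVec ρ B), form ρ (unitVec ρ C) (unitVec ρ A);
        form ρ (unitVec ρ A) (unitVec ρ B), ε, form ρ (unitVec ρ B) (unitVec ρ C);
        form ρ (unitVec ρ C) (unitVec ρ A), form ρ (unitVec ρ B) (unitVec ρ C), ε] := by
    ext i j
    fin_cases i <;> fin_cases j <;> simp [gram, frame, hAA, hBB, hCC] <;> exact form_comm _ _ _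
  rw [hG, Matrix.adjugate_fin_three_of]
  simp [mul_pow, e2, ← pow_two]

theorem abs_mul_eq_abs_mul {x y : ℝ} (h : 0 < x * y) : |y| * x = |x| * y := by
  rcases pos_and_pos_or_neg_and_neg_of_mul_pos h with ⟨h1, h2⟩ | ⟨h1, h2⟩
  · rw [abs_of_pos h1, abs_of_pos h2, mul_comm]
  · rw [abs_of_neg h1, abs_of_neg h2]; ring

/-- The images of the vertices under the reflection in an angle bisector. -/
theorem NormalFrame.mirror_eq {A B C : Plane}
    (h : NormalFrame ρ ε (unitVec ρ A) (unitVec ρ B) (unitVec ρ C)) :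
    ∃ t : ℝ, t ≠ 0 ∧
      t ^ 2 * (1 - (ε * form ρ (unitVec ρ C) (unitVec ρ A)) ^ 2) =
        1 - (ε * form ρ (unitVec ρ A) (unitVec ρ B)) ^ 2 ∧
      mirror ρ A B C (unitVec ρ B) = t • unitVec ρ C +
        (ε * form ρ (unitVec ρ A) (unitVec ρ B) -
          t * (ε * form ρ (unitVec ρ C) (unitVec ρ A))) • unitVec ρ A ∧
      mirror ρ A B C (unitVec ρ C) = t⁻¹ • unitVec ρ B +
        (ε * form ρ (unitVec ρ C) (unitVec ρ A) -
          t⁻¹ * (ε * form ρ (unitVec ρ A) (unitVec ρ B))) • unitVec ρ A := by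
  obtain ⟨δ, hδ, h0, h1, h2⟩ := h.dualGram_diag
  have hd1 : √|dualGram ρ A B C 1 1| ≠ 0 := by
    rw [h1]; exact (Real.sqrt_pos.2 (abs_pos.2 (mul_ne_zero hδ h.ca_ne))).ne'
  have hd2 : √|dualGram ρ A B C 2 2| ≠ 0 := by
    rw [h2]; exact (Real.sqrt_pos.2 (abs_pos.2 (mul_ne_zero hδ h.ab_ne))).ne'
  have hsq : √|dualGram ρ A B C 2 2| ^ 2 *
      (1 - (ε * form ρ (unitVec ρ C) (unitVec ρ A)) ^ 2) = √|dualGram ρ A B C 1 1| ^ 2 *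
      -- The absolute values under the roots are harmless because the two Gram determinants have the
      -- same sign.
      (1 - (ε * form ρ (unitVec ρ A) (unitVec ρ B)) ^ 2) := by
    rw [Real.sq_sqrt (abs_nonneg _), Real.sq_sqrt (abs_nonneg _), h1, h2, abs_mul, abs_mul,
      mul_assoc, mul_assoc, abs_mul_eq_abs_mul h.ca_ab]
  have hI : incenter ρ A B C = √|dualGram ρ A B C 0 0| • unitVec ρ A +
      √|dualGram ρ A B C 1 1| • unitVec ρ B + √|dualGram ρ A B C 2 2| • unitVec ρ C := by
    simp [incenter, Fin.sum_univ_three, frame]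
  set n := dualVec ρ (crossProduct (unitVec ρ A) (incenter ρ A B C)) with hn
  have hna : form ρ n (unitVec ρ A) = 0 := by
    rw [hn, form_dualVec, dotProduct_comm, dot_self_cross, mul_zero]
  have hni : form ρ n (incenter ρ A B C) = 0 := by
    rw [hn, form_dualVec, dotProduct_comm, dot_cross_self, mul_zero]
  have hn0 : n ≠ 0 := by
    intro hn0
    have h3 : form ρ n (unitVec ρ C) = ρ * (√|dualGram ρ A B C 1 1| *
        (unitVec ρ A ⬝ᵥ unitVec ρ B ⨯₃ unitVec ρ C)) := by
      rw [hn, form_dualVec, hI]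
      simp only [cross_apply, dotProduct, Fin.sum_univ_three, Matrix.cons_val, Pi.add_apply,
        Pi.smul_apply, smul_eq_mul]
      ring
    rw [hn0, form_zero_left] at h3
    exact mul_ne_zero h.metric_ne (mul_ne_zero hd1 h.vol) h3.symm
  rw [hI] at hni
  refine ⟨√|dualGram ρ A B C 2 2| / √|dualGram ρ A B C 1 1|, div_ne_zero hd2 hd1, ?_,
    h.reflection_eq hd1 hd2 hsq hn0 hna hni, ?_⟩
  · rw [div_pow, div_mul_eq_mul_div, hsq, mul_div_cancel_left₀ _ (pow_ne_zero 2 hd1)]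
  · rw [inv_div]
    have := h.swap.reflection_eq (d₁ := √|dualGram ρ A B C 0 0|) hd2 hd1
      (by rw [form_comm ρ (unitVec ρ B), form_comm ρ (unitVec ρ A) (unitVec ρ C), hsq]) hn0 hna
      (by rw [add_right_comm]; exact hni)
    rwa [form_comm ρ (unitVec ρ B), form_comm ρ (unitVec ρ A) (unitVec ρ C)] at this

theorem NormalFrame.mirror_self (A B C : Plane) :
    mirror ρ A B C (unitVec ρ A) = unitVec ρ A :=
  reflection_eq_self (by rw [form_dualVec, dotProduct_comm, dot_self_cross, mul_zero])

/-! ### Vectors with given products with the basis -/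

/-- The vector whose products with the basis vectors `A°, B°, C°` are given. -/
noncomputable def vecOfDual (ρ : ℝ) (A B C : Plane) (F : Fin 3 → ℝ) : Fin 3 → ℝ :=
  ∑ i, (dualGram ρ A B C *ᵥ F) i • frame ρ A B C i

theorem vecOfDual_add (A B C : Plane) (F G : Fin 3 → ℝ) :
    vecOfDual ρ A B C (F + G) = vecOfDual ρ A B C F + vecOfDual ρ A B C G := by
  simp [vecOfDual, Matrix.mulVec_add, add_smul, Finset.sum_add_distrib]

theorem vecOfDual_smul (A B C : Plane) (r : ℝ) (F : Fin 3 → ℝ) :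
    vecOfDual ρ A B C (r • F) = r • vecOfDual ρ A B C F := by
  simp [vecOfDual, Matrix.mulVec_smul, mul_smul, Finset.smul_sum]

theorem NormalFrame.form_vecOfDual {A B C : Plane}
    (h : NormalFrame ρ ε (unitVec ρ A) (unitVec ρ B) (unitVec ρ C)) (F : Fin 3 → ℝ) (j : Fin 3) :
    form ρ (vecOfDual ρ A B C F) (frame ρ A B C j) = F j := by
  have h1 : (gram ρ A B C) *ᵥ (dualGram ρ A B C *ᵥ F) = F := by
    rw [dualGram_eq, Matrix.mulVec_mulVec,
      Matrix.mul_nonsing_inv _ (isUnit_iff_ne_zero.2 h.det_gram_ne_zero), Matrix.one_mulVec]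
  have h2 := congrFun h1 j
  rw [← h2, vecOfDual]
  generalize dualGram ρ A B C *ᵥ F = v
  simp only [Fin.sum_univ_three, form_add_left, form_smul_left, Matrix.mulVec, dotProduct, gram,
    Matrix.of_apply, form_comm ρ (frame ρ A B C j)]
  ring

theorem circumcenter_eq_vecOfDual (A B C : Plane) :
    circumcenter ρ A B C = vecOfDual ρ A B C 1 := by
  simp [circumcenter, vecOfDual, Matrix.mulVec, dotProduct]

theorem NormalFrame.symmedian_eq_vecOfDual {A B C : Plane}
    (h : NormalFrame ρ ε (unitVec ρ A) (unitVec ρ B) (unitVec ρ C)) :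
    symmedian ρ A B C =
      vecOfDual ρ A B C (gram ρ A B C *ᵥ fun i => dualGram ρ A B C i i) := by
  rw [vecOfDual, dualGram_eq, Matrix.mulVec_mulVec,
    Matrix.nonsing_inv_mul _ (isUnit_iff_ne_zero.2 h.det_gram_ne_zero), Matrix.one_mulVec]
  rfl

/-! ### Circles -/

namespace IsCircle

variable {M : Matrix (Fin 3) (Fin 3) ℝ} {m : Fin 3 → ℝ}

/-- A linear map for which every vector is an eigenvector is scalar: the eigenvalues of `u`, `x` and
`u + x` are compared. -/
theorem exists_axis_eq (h : IsCircle ρ M m) (hρ : ρ ≠ 0) :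
    ∃ r : ℝ, ∀ x, form ρ m x = 0 → M *ᵥ x = r • (metricMatrix ρ *ᵥ x) := by
  by_cases hu : ∃ u, u ≠ 0 ∧ form ρ m u = 0
  · obtain ⟨u, hu0, hu⟩ := hu
    obtain ⟨r, hr⟩ := h.axis u hu
    refine ⟨r, fun x hx => ?_⟩
    obtain ⟨t, ht⟩ := h.axis x hx
    obtain ⟨s, hs⟩ := h.axis (u + x) (by rw [form_add_right, hu, hx, add_zero])
    have h1 : (r - s) • u + (t - s) • x = 0 := by
      apply metricMatrix_mulVec_injective hρ
      rw [Matrix.mulVec_add, hr, ht, Matrix.mulVec_add] at hs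
      rw [Matrix.mulVec_add, Matrix.mulVec_smul, Matrix.mulVec_smul]
      rw [← sub_eq_zero] at hs
      rw [← hs]
      module
    rcases eq_or_ne t s with hts | hts
    · rw [hts, sub_self, zero_smul, add_zero, smul_eq_zero, sub_eq_zero] at h1
      rw [ht, hts, h1.resolve_right hu0]
    · have h2 : x = (-(r - s) / (t - s)) • u := by
        rw [div_eq_inv_mul, mul_smul, neg_smul, eq_inv_smul_iff₀ (sub_ne_zero.2 hts)]
        rw [← add_eq_zero_iff_eq_neg, add_comm]
        exact h1
      rw [h2, Matrix.mulVec_smul, hr, Matrix.mulVec_smul, smul_comm]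
  · refine ⟨0, fun x hx => ?_⟩
    by_cases hx0 : x = 0
    · simp [hx0]
    · exact absurd ⟨x, hx0, hx⟩ hu

/-- A circle belongs to the pencil spanned by the absolute conic and its doubled axis. Splitting off
a vector `w` with `⟨m,w⟩ = 1` reduces the claim to vectors on the axis and to `w` itself. -/
theorem exists_form_eq (h : IsCircle ρ M m) (hρ : ρ ≠ 0) :
    ∃ r κ : ℝ, r ≠ 0 ∧ κ ≠ 0 ∧
      ∀ x y, x ⬝ᵥ (M *ᵥ y) = r * form ρ x y + κ * form ρ m x * form ρ m y := by
  obtain ⟨r, hr⟩ := h.exists_axis_eq hρ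
  obtain ⟨w, hw⟩ : ∃ w, form ρ m w = 1 := by
    by_contra! hw
    refine h.center_ne (eq_zero_of_form_eq_zero hρ fun y => ?_)
    by_contra hy
    exact hw ((form ρ m y)⁻¹ • y) (by rw [form_smul_right, inv_mul_cancel₀ hy])
  have hsymm : ∀ x y, x ⬝ᵥ (M *ᵥ y) = y ⬝ᵥ (M *ᵥ x) := by
    intro x y
    rw [Matrix.dotProduct_mulVec, ← Matrix.mulVec_transpose, h.symm, dotProduct_comm]
  have hr' : ∀ x y, form ρ m y = 0 → x ⬝ᵥ (M *ᵥ y) = r * form ρ x y := by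
    intro x y hy
    rw [hr y hy, dotProduct_smul, smul_eq_mul, form]
  have key : ∀ x y, x ⬝ᵥ (M *ᵥ y) = r * form ρ x y +
      (w ⬝ᵥ (M *ᵥ w) - r * form ρ w w) * form ρ m x * form ρ m y := by
    intro x y
    obtain ⟨α, hα⟩ : ∃ α, α = form ρ m x := ⟨_, rfl⟩
    obtain ⟨β, hβ⟩ : ∃ β, β = form ρ m y := ⟨_, rfl⟩
    have hx : form ρ m (x - α • w) = 0 := by
      rw [form_sub_right, form_smul_right, hw, ← hα]; ring
    have hy : form ρ m (y - β • w) = 0 := by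
      rw [form_sub_right, form_smul_right, hw, ← hβ]; ring
    have h1 := hr' x _ hy
    have h2 := hr' w _ hx
    rw [Matrix.mulVec_sub, Matrix.mulVec_smul, dotProduct_sub, dotProduct_smul, form_sub_right,
      form_smul_right, smul_eq_mul] at h1 h2
    rw [← hα, ← hβ]
    rw [hsymm w x, form_comm ρ w x] at h2
    linear_combination h1 + β * h2
  refine ⟨r, _, ?_, ?_, key⟩
  -- Without the metric term the form is a multiple of a square, hence not indefinite.
  · rintro rfl
    obtain ⟨x, hx⟩ := h.pos
    obtain ⟨y, hy⟩ := h.neg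
    rw [key] at hx hy
    have h1 := mul_self_nonneg (form ρ m x)
    have h2 := mul_self_nonneg (form ρ m y)
    rcases le_total 0 (w ⬝ᵥ (M *ᵥ w)) with h3 | h3
    · nlinarith [mul_nonneg h3 h2]
    · nlinarith [mul_nonneg (neg_nonneg.2 h3) h1]
  · intro h0
    refine h.not_absolute r ?_
    ext i j
    have := key (Pi.single i 1) (Pi.single j 1)
    rw [h0, zero_mul, zero_mul, add_zero, form] at this
    simpa using this

/-- The equation of a circle with a point on it whose scalar square has the sign `ε`. -/
theorem exists_form_eq_of_mem (h : IsCircle ρ M m) (hρ : ρ ≠ 0) (hε : ε * ε = 1)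
    {p : Fin 3 → ℝ} (hp : p ⬝ᵥ (M *ᵥ p) = 0) (hpp : 0 < ε * form ρ p p) :
    ∃ c : ℝ, 0 < c ∧ ∃ r : ℝ, r ≠ 0 ∧ ∀ x y, x ⬝ᵥ (M *ᵥ y) =
      r * (ε * form ρ x y - form ρ (c • m) x * form ρ (c • m) y) := by
  obtain ⟨r, κ, hr, hκ, H⟩ := h.exists_form_eq hρ
  have h1 : ε * form ρ p p = -(κ * ε / r) * form ρ m p ^ 2 := by
    rw [H] at hp
    field_simp
    linear_combination ε * hp
  rw [h1] at hpp
  -- The square root of this number is the factor that normalizes the center.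
  have h2 : 0 < -(κ * ε / r) := pos_of_mul_pos_left hpp (sq_nonneg _)
  refine ⟨√(-(κ * ε / r)), Real.sqrt_pos.2 h2, r * ε, mul_ne_zero hr (left_ne_zero_of_mul
    (hε ▸ one_ne_zero)), fun x y => ?_⟩
  rw [form_smul_left, form_smul_left, H]
  have h3 := Real.mul_self_sqrt h2.le
  have h4 : r * (κ * ε / r) = κ * ε := by field_simp
  linear_combination (-r * form ρ x y - κ * form ρ m x * form ρ m y) * hε +
    r * ε * form ρ m x * form ρ m y * h3 - ε * form ρ m x * form ρ m y * h4

end IsCircle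

/-- The matrix of the quadratic form `ε ⟨x, x⟩ - ⟨m, x⟩²`. -/
noncomputable def circleMatrix (ρ ε : ℝ) (m : Fin 3 → ℝ) : Matrix (Fin 3) (Fin 3) ℝ :=
  ε • metricMatrix ρ - Matrix.vecMulVec (metricMatrix ρ *ᵥ m) (metricMatrix ρ *ᵥ m)

theorem circleMatrix_mulVec (m x : Fin 3 → ℝ) :
    circleMatrix ρ ε m *ᵥ x =
      ε • (metricMatrix ρ *ᵥ x) - form ρ m x • (metricMatrix ρ *ᵥ m) := by
  rw [circleMatrix, Matrix.sub_mulVec, Matrix.smul_mulVec, Matrix.vecMulVec_mulVec, form_comm,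
    form, dotProduct_comm x]
  simp

theorem dotProduct_circleMatrix (m x y : Fin 3 → ℝ) :
    x ⬝ᵥ (circleMatrix ρ ε m *ᵥ y) = ε * form ρ x y - form ρ m x * form ρ m y := by
  rw [circleMatrix_mulVec, dotProduct_sub, dotProduct_smul, dotProduct_smul, ← form, ← form,
    form_comm ρ x m, smul_eq_mul, smul_eq_mul, mul_comm (form ρ m y)]

theorem isSymm_circleMatrix (m : Fin 3 → ℝ) : (circleMatrix ρ ε m).IsSymm := by
  refine Matrix.IsSymm.sub (Matrix.IsSymm.smul (Matrix.isSymm_diagonal _) _) ?_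
  rw [Matrix.IsSymm, Matrix.transpose_vecMulVec]

theorem eq_zero_of_quadratic_nonneg {x y : ℝ} (h : ∀ t : ℝ, 0 ≤ 2 * t * x + t ^ 2 * y) :
    x = 0 := by
  have h0 : 0 < 1 + |y| := by positivity
  -- The denominator `1 + |y|` replaces `y`, which may be zero or negative.
  have h1 := h (-x / (1 + |y|))
  have h2 : 2 * (-x / (1 + |y|)) * x + (-x / (1 + |y|)) ^ 2 * y =
      (x / (1 + |y|)) ^ 2 * (y - 2 * (1 + |y|)) := by field_simp; ring
  rw [h2] at h1
  have h3 : y - 2 * (1 + |y|) < 0 := by linarith [le_abs_self y, abs_nonneg y]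
  have h4 : (x / (1 + |y|)) ^ 2 = 0 :=
    le_antisymm (nonpos_of_mul_nonneg_left h1 h3) (sq_nonneg _)
  simpa [h0.ne'] using h4

/-- A zero of a semidefinite quadratic form lies in its radical. This serves to show that a conic
with two real points is indefinite. -/
theorem form_eq_of_semidefinite {m p : Fin 3 → ℝ} (σ : ℝ) (hσ : σ ≠ 0)
    (h : ∀ x, 0 ≤ σ * (ε * form ρ x x - form ρ m x * form ρ m x))
    (hp : ε * form ρ p p - form ρ m p * form ρ m p = 0) (y : Fin 3 → ℝ) :
    ε * form ρ p y = form ρ m p * form ρ m y := by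
  have h1 := eq_zero_of_quadratic_nonneg (x := σ * (ε * form ρ p y - form ρ m p * form ρ m y))
    (y := σ * (ε * form ρ y y - form ρ m y * form ρ m y)) fun t => by
      have h2 := h (p + t • y)
      simp only [form_add_left, form_add_right, form_smul_left, form_smul_right,
        form_comm ρ y p] at h2
      linarith [congrArg (σ * ·) hp]
  exact sub_eq_zero.1 ((mul_eq_zero.1 h1).resolve_left hσ)

/-- The conic `ε ⟨x, x⟩ = ⟨m, x⟩²` is a circle if it has two points. -/
theorem isCircle_circleMatrix (hρ : ρ ≠ 0) (hε : ε * ε = 1) {m p q : Fin 3 → ℝ} (hm : m ≠ 0)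
    (hp : ε * form ρ p p = form ρ m p ^ 2) (hq : ε * form ρ q q = form ρ m q ^ 2)
    (hpq : LinearIndependent ℝ ![p, q]) : IsCircle ρ (circleMatrix ρ ε m) m := by
  have hε0 : ε ≠ 0 := left_ne_zero_of_mul (hε ▸ one_ne_zero)
  have key : ∀ σ : ℝ, σ ≠ 0 →
      ¬ ∀ x, 0 ≤ σ * (ε * form ρ x x - form ρ m x * form ρ m x) := by
    intro σ hσ h
    have h1 := form_eq_of_semidefinite σ hσ h (p := p) (by rw [hp]; ring)
    have h2 := form_eq_of_semidefinite σ hσ h (p := q) (by rw [hq]; ring)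
    -- Both `⟨p,·⟩` and `⟨q,·⟩` are multiples of `⟨m,·⟩`, so `p` and `q` are dependent because the
    -- metric is nondegenerate.
    have h3 : form ρ m q • p + (-form ρ m p) • q = 0 := by
      refine eq_zero_of_form_eq_zero hρ fun y => ?_
      apply (mul_eq_zero.1 _).resolve_left hε0
      rw [form_add_left, form_smul_left, form_smul_left]
      linear_combination form ρ m q * h1 y - form ρ m p * h2 y
    have h4 := LinearIndependent.pair_iff.1 hpq _ _ h3
    have h5 : p = 0 := by
      refine eq_zero_of_form_eq_zero hρ fun y => ?_
      apply (mul_eq_zero.1 _).resolve_left hε0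
      rw [h1, neg_eq_zero.1 h4.2, zero_mul]
    exact hpq.ne_zero 0 h5
  refine ⟨isSymm_circleMatrix m, ?_, ?_, ?_, hm, fun x hx => ⟨ε, ?_⟩⟩
  · by_contra! h
    refine key (-1) (by norm_num) fun x => ?_
    have := h x
    rw [dotProduct_circleMatrix] at this
    linarith
  · by_contra! h
    refine key 1 one_ne_zero fun x => ?_
    have := h x
    rw [dotProduct_circleMatrix] at this
    linarith
  · intro r h
    have h1 : ∀ x y, (ε - r) * form ρ x y = form ρ m x * form ρ m y := by
      intro x y
      have := dotProduct_circleMatrix (ρ := ρ) (ε := ε) m x y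
      rw [h, Matrix.smul_mulVec, dotProduct_smul, ← form, smul_eq_mul] at this
      linarith
    have hp' := h1 p
    have hq' := h1 q
    by_cases hr : ε - r = 0
    · refine hm (eq_zero_of_form_eq_zero hρ fun y => ?_)
      have := h1 y y
      rw [hr, zero_mul] at this
      exact mul_self_eq_zero.1 this.symm
    · have h3 : form ρ m q • p + (-form ρ m p) • q = 0 := by
        refine eq_zero_of_form_eq_zero hρ fun y => ?_
        apply (mul_eq_zero.1 _).resolve_left hr
        rw [form_add_left, form_smul_left, form_smul_left]
        linear_combination form ρ m q * hp' y - form ρ m p * hq' y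
      have h4 := LinearIndependent.pair_iff.1 hpq _ _ h3
      have h5 : p = 0 := by
        refine eq_zero_of_form_eq_zero hρ fun y => ?_
        apply (mul_eq_zero.1 _).resolve_left hr
        rw [h1, neg_eq_zero.1 h4.2, zero_mul]
      exact hpq.ne_zero 0 h5
  · rw [circleMatrix_mulVec, hx, zero_smul, sub_zero]

/-! ### Inner points of cords -/

/-- If both ends lie weakly on the same side of the tangent at `y`, an inner point can lie on it
only when both ends do. Then both are multiples of `y`, which independence forbids. -/
theorem inside_of_forall {M : Matrix (Fin 3) (Fin 3) ℝ} {p q : Fin 3 → ℝ}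
    (hpq : LinearIndependent ℝ ![p, q])
    (H : ∀ y, y ≠ 0 → y ⬝ᵥ (M *ᵥ y) = 0 → ∃ σ : ℝ, ∀ x, x = p ∨ x = q →
      0 ≤ σ * (x ⬝ᵥ (M *ᵥ y)) ∧ (σ * (x ⬝ᵥ (M *ᵥ y)) = 0 → ∃ r : ℝ, x = r • y))
    {s t : ℝ} (hs : 0 < s) (ht : 0 < t) : Inside M (s • p + t • q) := by
  intro y hy hMy h0
  obtain ⟨σ, hσ⟩ := H y hy hMy
  obtain ⟨hp, hp'⟩ := hσ p (Or.inl rfl)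
  obtain ⟨hq, hq'⟩ := hσ q (Or.inr rfl)
  rw [add_dotProduct, smul_dotProduct, smul_dotProduct, smul_eq_mul, smul_eq_mul] at h0
  have h1 : s * (σ * (p ⬝ᵥ (M *ᵥ y))) + t * (σ * (q ⬝ᵥ (M *ᵥ y))) = 0 := by
    linear_combination σ * h0
  have h2 := mul_nonneg hs.le hp
  have h3 := mul_nonneg ht.le hq
  obtain ⟨r, hr⟩ := hp' ((mul_eq_zero.1 (by linarith)).resolve_left hs.ne')
  obtain ⟨r', hr'⟩ := hq' ((mul_eq_zero.1 (by linarith)).resolve_left ht.ne')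
  have h4 : r' • p + (-r) • q = 0 := by
    rw [hr, hr']; module
  have h5 := (LinearIndependent.pair_iff.1 hpq _ _ h4).2
  exact hpq.ne_zero 0 (by rw [Matrix.cons_val_zero, hr, neg_eq_zero.1 h5, zero_smul])

theorem form_self_pos (hρ : 0 < ρ) {x : Fin 3 → ℝ} (hx : x ≠ 0) : 0 < form ρ x x := by
  obtain ⟨i, hi⟩ := Function.ne_iff.1 hx
  have h := mul_self_pos.2 hi
  have h0 := mul_nonneg hρ.le (mul_self_nonneg (x 0))
  have h1 := mul_self_nonneg (x 1)
  have h2 := mul_self_nonneg (x 2)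
  rw [form_apply]
  fin_cases i
  · have := mul_pos hρ h
    simp only [Fin.zero_eta] at this
    linarith
  · simp only [Fin.mk_one] at h
    linarith
  · simp only [Fin.reduceFinMk] at h
    linarith

/-- For `x`, `y` on the circle, the scalar square of `⟨m,y⟩x - ⟨m,x⟩y` is, up to a positive factor,
the signed value of the tangent at `y` in `x`. Definiteness gives the sign and the case of equality.
-/
theorem inside_circleMatrix_of_pos (hρ : 0 < ρ) {m p q : Fin 3 → ℝ}
    (hpq : LinearIndependent ℝ ![p, q]) (hp : form ρ p p = form ρ m p ^ 2)
    (hq : form ρ q q = form ρ m q ^ 2) (hp0 : 0 ≤ form ρ m p) (hq0 : 0 ≤ form ρ m q)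
    {s t : ℝ} (hs : 0 < s) (ht : 0 < t) : Inside (circleMatrix ρ 1 m) (s • p + t • q) := by
  refine inside_of_forall hpq (fun y hy hMy => ⟨-form ρ m y, fun x hx => ?_⟩) hs ht
  have hx' : form ρ x x = form ρ m x ^ 2 ∧ 0 ≤ form ρ m x ∧ x ≠ 0 := by
    rcases hx with rfl | rfl
    · exact ⟨hp, hp0, hpq.ne_zero 0⟩
    · exact ⟨hq, hq0, hpq.ne_zero 1⟩
  obtain ⟨hx1, hx2, hx3⟩ := hx'
  rw [dotProduct_circleMatrix] at hMy ⊢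
  have h1 : 0 < form ρ m x := by
    have := form_self_pos hρ hx3
    rw [hx1] at this
    exact lt_of_le_of_ne hx2 fun h => by rw [← h] at this; norm_num at this
  have h2 : form ρ (form ρ m y • x - form ρ m x • y) (form ρ m y • x - form ρ m x • y) =
      2 * form ρ m x * (-form ρ m y * (1 * form ρ x y - form ρ m x * form ρ m y)) := by
    simp only [form_sub_left, form_sub_right, form_smul_left, form_smul_right, form_comm ρ y x]
    linear_combination form ρ m y ^ 2 * hx1 + form ρ m x ^ 2 * hMy
  have h3 : form ρ m y ≠ 0 := by
    have := form_self_pos hρ hy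
    intro h
    rw [h] at hMy
    linarith
  by_cases h4 : form ρ m y • x - form ρ m x • y = 0
  · rw [h4, form_zero_left] at h2
    have h5 := (mul_eq_zero.1 h2.symm).resolve_left (by positivity)
    refine ⟨h5.ge, fun _ => ⟨(form ρ m y)⁻¹ * form ρ m x, ?_⟩⟩
    rw [mul_smul, ← sub_eq_zero.1 h4, inv_smul_smul₀ h3]
  · have h5 := form_self_pos hρ h4
    rw [h2] at h5
    have h6 := pos_of_mul_pos_right h5 (by positivity)
    exact ⟨h6.le, fun h => absurd h h6.ne'⟩

/-- Points of the circle become null vectors under `x ↦ (x₀, x₁, x₂, ⟨m,x⟩)`, with `x₀` as time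
coordinate, and the sum of squares below is the reversed Cauchy–Schwarz inequality for them.
Positive first coordinates take the place of the branch condition. -/
theorem inside_circleMatrix_of_neg {m p q : Fin 3 → ℝ}
    (hpq : LinearIndependent ℝ ![p, q]) (hp : -form ρ p p = form ρ m p ^ 2)
    (hq : -form ρ q q = form ρ m q ^ 2) (hp0 : 0 < p 0) (hq0 : 0 < q 0)
    {s t : ℝ} (hs : 0 < s) (ht : 0 < t) : Inside (circleMatrix ρ (-1) m) (s • p + t • q) := by
  refine inside_of_forall hpq (fun y hy hMy => ⟨y 0, fun x hx => ?_⟩) hs ht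
  have hx' : -form ρ x x = form ρ m x ^ 2 ∧ 0 < x 0 := by
    rcases hx with rfl | rfl
    · exact ⟨hp, hp0⟩
    · exact ⟨hq, hq0⟩
  obtain ⟨hx1, hx2⟩ := hx'
  rw [dotProduct_circleMatrix] at hMy ⊢
  have h2 : 2 * x 0 * (y 0 * (-1 * form ρ x y - form ρ m x * form ρ m y)) =
      (y 0 * x 1 - x 0 * y 1) ^ 2 + (y 0 * x 2 - x 0 * y 2) ^ 2 +
        (y 0 * form ρ m x - x 0 * form ρ m y) ^ 2 := by
    simp only [form_apply ρ x, form_apply ρ y] at hx1 hMy ⊢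
    linear_combination y 0 ^ 2 * hx1 + x 0 ^ 2 * hMy
  have hy0 : y 0 ≠ 0 := by
    intro h0
    refine hy ?_
    rw [form_apply ρ y, h0] at hMy
    have h3 := mul_self_nonneg (form ρ m y)
    have h4 : y 1 = 0 := by nlinarith [mul_self_nonneg (y 1), mul_self_nonneg (y 2)]
    have h5 : y 2 = 0 := by nlinarith [mul_self_nonneg (y 1), mul_self_nonneg (y 2)]
    ext i
    fin_cases i <;> assumption
  have h3 : 0 ≤ 2 * x 0 * (y 0 * (-1 * form ρ x y - form ρ m x * form ρ m y)) := by
    rw [h2]; positivity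
  refine ⟨nonneg_of_mul_nonneg_right h3 (by positivity), fun h => ⟨x 0 / y 0, ?_⟩⟩
  rw [h, mul_zero] at h2
  have h4 : y 0 * x 1 - x 0 * y 1 = 0 := by
    apply pow_eq_zero_iff two_ne_zero |>.1
    linarith [sq_nonneg (y 0 * x 1 - x 0 * y 1), sq_nonneg (y 0 * x 2 - x 0 * y 2),
      sq_nonneg (y 0 * form ρ m x - x 0 * form ρ m y)]
  have h5 : y 0 * x 2 - x 0 * y 2 = 0 := by
    apply pow_eq_zero_iff two_ne_zero |>.1
    linarith [sq_nonneg (y 0 * x 1 - x 0 * y 1), sq_nonneg (y 0 * x 2 - x 0 * y 2),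
      sq_nonneg (y 0 * form ρ m x - x 0 * form ρ m y)]
  ext i
  fin_cases i
  · simp [hy0]
  · simp only [Fin.mk_one, Pi.smul_apply, smul_eq_mul]
    field_simp
    linarith
  · simp only [Fin.reduceFinMk, Pi.smul_apply, smul_eq_mul]
    field_simp
    linarith

/-! ### Antiparallel and parallel lines in terms of linear functionals -/

/-- The functional with the values `φ` and `1` at `X` and `Y` takes at the point `p` of the line
through `X` and `Y`, different from `X` and `Y`, the value `√(ε ⟨p, p⟩)`. -/
def IsCut (ρ ε : ℝ) (X Y p : Fin 3 → ℝ) (φ : ℝ) : Prop :=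
  ∃ u v : ℝ, u ≠ 0 ∧ v ≠ 0 ∧ p = u • X + v • Y ∧ 0 ≤ u * φ + v ∧
    (u * φ + v) ^ 2 = ε * form ρ p p

theorem isCut_of_form {m X Y p : Fin 3 → ℝ} {u v φ : ℝ} (hu : u ≠ 0) (hv : v ≠ 0)
    (hp : p = u • X + v • Y) (hX : form ρ m X = φ) (hY : form ρ m Y = 1)
    (h0 : 0 ≤ form ρ m p) (h1 : ε * form ρ p p = form ρ m p ^ 2) : IsCut ρ ε X Y p φ := by
  have : form ρ m p = u * φ + v := by
    rw [hp, form_add_right, form_smul_right, form_smul_right, hX, hY, mul_one]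
  exact ⟨u, v, hu, hv, hp, this ▸ h0, by rw [h1, this]⟩

namespace NormalFrame

variable {a b c : Fin 3 → ℝ}

/-- Two different lines meet in one point only. This identifies the corners of the chain in a cord
condition. -/
theorem exists_smul_of_mem (h : NormalFrame ρ ε a b c) {x p : Fin 3 → ℝ} {u v : ℝ}
    (hx : x ∈ Submodule.span ℝ {a, c}) (hx' : x ∈ Submodule.span ℝ {p, u • a + v • b})
    (hp : p ∈ Submodule.span ℝ {a, c}) (hv : v ≠ 0) : ∃ s : ℝ, x = s • p := by
  obtain ⟨x₁, x₂, rfl⟩ := Submodule.mem_span_pair.1 hx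
  obtain ⟨p₁, p₂, rfl⟩ := Submodule.mem_span_pair.1 hp
  obtain ⟨s, t, hst⟩ := Submodule.mem_span_pair.1 hx'
  have h1 := (h.coord_eq_zero (u := s * p₁ + t * u - x₁) (v := t * v) (w := s * p₂ - x₂) (by
    rw [← sub_eq_zero] at hst
    rw [← hst]
    module)).2.1
  have h2 : t = 0 := (mul_eq_zero.1 h1).resolve_right hv
  exact ⟨s, by rw [← hst, h2]; module⟩

theorem notMem_span (h : NormalFrame ρ ε a b c) {u v w : ℝ} (hu : u ≠ 0) :
    u • a + v • b + w • c ∉ Submodule.span ℝ {b, c} := by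
  intro h0
  obtain ⟨s, t, hst⟩ := Submodule.mem_span_pair.1 h0
  exact hu (h.coord_eq_zero (u := u) (v := v - s) (w := w - t) (by
    rw [← sub_eq_zero] at hst
    rw [← neg_zero, ← hst]
    module)).1

theorem notMem_span_self (h : NormalFrame ρ ε a b c) : a ∉ Submodule.span ℝ {b, c} := by
  simpa using h.notMem_span (u := 1) (v := 0) (w := 0) one_ne_zero

end NormalFrame

theorem eq_one_of_sq {x : ℝ} (h0 : 0 ≤ x) (h : x ^ 2 = 1) : x = 1 :=
  (pow_eq_one_iff_of_nonneg h0 two_ne_zero).1 h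

section Vertex

variable {A B C P Q : Plane} {u v x y : ℝ}

/-- The value at `X°` of a functional that is nonnegative with square `ε ⟨p, p⟩` at a positive
multiple `p` of `X°`. -/
theorem form_eq_one {X p m : Fin 3 → ℝ} {r : ℝ} (hr : 0 < r) (hp : p = r • X)
    (hX : ε * form ρ X X = 1) (h0 : 0 ≤ form ρ m p) (h1 : ε * form ρ p p = form ρ m p ^ 2) :
    form ρ m X = 1 := by
  rw [hp, form_smul_right] at h0 h1
  rw [form_smul_left, form_smul_right] at h1
  refine eq_one_of_sq (nonneg_of_mul_nonneg_right h0 hr) ?_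
  have : r ^ 2 ≠ 0 := by positivity
  apply mul_left_cancel₀ this
  linear_combination -h1 + r ^ 2 * hX

/-- The corner `p 2` fixes the normalization of the center, because in both applications it is a
vertex or the mirror image of one and so has sign `ε`. -/
theorem AreCords.exists_form_eq {inner : Prop} {M : Matrix (Fin 3) (Fin 3) ℝ} {m : Fin 3 → ℝ}
    {l : Fin 4 → Line} {p : Fin 4 → Fin 3 → ℝ} (h : AreCords ρ inner M m l p) (hρ : ρ ≠ 0)
    (hε : ε * ε = 1) (hp : 0 < ε * form ρ (p 2) (p 2)) :
    ∃ n : Fin 3 → ℝ, (∀ i, 0 ≤ form ρ n (p i)) ∧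
      (∀ i, ε * form ρ (p i) (p i) = form ρ n (p i) ^ 2) ∧
      ∀ i, Submodule.span ℝ {p i} = Submodule.span ℝ {p (i + 1)} →
        ∀ x ∈ l i, ε * form ρ x (p i) = form ρ n x * form ρ n (p i) := by
  obtain ⟨c, hc, r, hr, H⟩ := h.circle.exists_form_eq_of_mem hρ hε (h.mem 2) hp
  refine ⟨c • m, fun i => ?_, fun i => ?_, fun i hi x hx => ?_⟩
  · rw [form_smul_left]
    exact mul_nonneg hc.le (h.branch i)
  · have := h.mem i
    rw [H] at this
    linarith [(mul_eq_zero.1 this).resolve_left hr]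
  · have := h.tangent i hi x hx
    rw [H] at this
    linarith [(mul_eq_zero.1 this).resolve_left hr]

/-- The corners of the chain are forced to be `P, Q, B, C`. The normalized functional is `1` at `B°`
and `C°`, and `φ` is its value at `A°`. -/
theorem Antiparallel.exists_isCut (hABC : IsClassicalTriple ρ A B C)
    (hF : NormalFrame ρ ε (unitVec ρ A) (unitVec ρ B) (unitVec ρ C))
    (hP : lift P = u • unitVec ρ A + v • unitVec ρ C)
    (hQ : lift Q = x • unitVec ρ A + y • unitVec ρ B)
    (hu : u ≠ 0) (hv : v ≠ 0) (hx : x ≠ 0) (hy : y ≠ 0)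
    (h : Antiparallel ρ A B C (join P Q) (join B C)) :
    ∃ φ, IsCut ρ ε (unitVec ρ A) (unitVec ρ C) (lift P) φ ∧
      IsCut ρ ε (unitVec ρ A) (unitVec ρ B) (lift Q) φ := by
  have hA := hABC.anisotropic
  have hB := hABC.rotate.anisotropic
  have hC := hABC.rotate.rotate.anisotropic
  obtain ⟨-, ⟨-, h1, -⟩ | ⟨R, ⟨h0, h0'⟩, ⟨h1', h1⟩, ⟨h2, h2'⟩, ⟨h3', h3⟩, -, M, m, H⟩⟩ := h
  · rw [onLine_iff, join_eq hB hC] at h1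
    obtain ⟨r, hr, hr'⟩ := lift_eq hA
    rw [hr', Submodule.smul_mem_iff _ hr.ne'] at h1
    exact absurd h1 hF.notMem_span_self
  · rw [join_eq hC hA, Set.pair_comm] at h0 h3
    rw [join_eq hA hB] at h1 h2
    rw [join_eq hB hC] at h2' h3'
    have hPm : lift P ∈ Submodule.span ℝ {unitVec ρ A, unitVec ρ C} :=
      Submodule.mem_span_pair.2 ⟨u, v, hP.symm⟩
    have hQm : lift Q ∈ Submodule.span ℝ {unitVec ρ A, unitVec ρ B} :=
      Submodule.mem_span_pair.2 ⟨x, y, hQ.symm⟩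
    obtain ⟨s₀, e₀⟩ := hF.exists_smul_of_mem h0 (by rw [← hQ, ← join_eq_lift]; exact h0') hPm hy
    obtain ⟨s₁, e₁⟩ := hF.swap.exists_smul_of_mem h1
      (by rw [← hP, Set.pair_comm, ← join_eq_lift]; exact h1') hQm hv
    obtain ⟨s₂, e₂⟩ := hF.swap.exists_smul_of_mem (u := 0) (v := 1) h2
      (by simpa using h2') (Submodule.subset_span (by simp)) one_ne_zero
    obtain ⟨s₃, e₃⟩ := hF.exists_smul_of_mem (u := 0) (v := 1) h3
      (by rw [Set.pair_comm]; simpa using h3') (Submodule.subset_span (by simp)) one_ne_zero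
    have E₀ := eq_of_lift_eq_smul e₀
    have E₁ := eq_of_lift_eq_smul e₁
    rw [unitVec_eq, smul_smul] at e₂ e₃
    have E₂ := eq_of_lift_eq_smul e₂
    have E₃ := eq_of_lift_eq_smul e₃
    obtain ⟨r₂, hr₂, hB'⟩ := lift_eq hB
    obtain ⟨r₃, hr₃, hC'⟩ := lift_eq hC
    obtain ⟨n, H0, H1, -⟩ := H.exists_form_eq hF.metric_ne hF.sq (by
      simp only [E₂, hB']
      rw [form_smul_left, form_smul_right]
      have : ε * (r₂ * (r₂ * form ρ (unitVec ρ B) (unitVec ρ B))) = r₂ * r₂ := by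
        linear_combination r₂ * r₂ * hF.bb
      rw [this]
      positivity)
    have hnB := form_eq_one hr₂ hB' hF.bb (E₂ ▸ H0 2) (E₂ ▸ H1 2)
    have hnC := form_eq_one hr₃ hC' hF.cc (E₃ ▸ H0 3) (E₃ ▸ H1 3)
    exact ⟨form ρ n (unitVec ρ A), isCut_of_form hu hv hP rfl hnC (E₀ ▸ H0 0) (E₀ ▸ H1 0),
      isCut_of_form hx hy hQ rfl hnB (E₁ ▸ H0 1) (E₁ ▸ H1 1)⟩

/-- The quadratic condition has the factor `w`; dividing by it leaves a relation linear in `z` and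
`w`. For `w = 0`, when the point is the corner itself, tangency supplies that relation. -/
theorem cut_identity {z w ψ g : ℝ} (hz : z ≠ 0) (hg : 1 - g ^ 2 ≠ 0)
    (h : (z + ψ * w) ^ 2 = z ^ 2 + w ^ 2 + 2 * z * w * g) (h0 : w = 0 → ψ = g) :
    1 + ψ ≠ 0 ∧ (z + ψ * w - w - z * g) * (1 + ψ) = z * (1 + g) * (1 - ψ) := by
  have h1 : w * (1 - ψ ^ 2) = 2 * z * (ψ - g) := by
    by_cases hw : w = 0
    · rw [hw, h0 hw]; ring
    · apply mul_left_cancel₀ hw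
      linear_combination -h
  refine ⟨fun h2 => hg ?_, by linear_combination -h1⟩
  have h3 : ψ = g := by
    have h4 : 2 * z * (ψ - g) = 0 := by rw [← h1]; linear_combination w * (1 - ψ) * h2
    have h5 := (mul_eq_zero.1 h4).resolve_left (by positivity)
    linarith
  rw [← h3]
  linear_combination (1 - ψ) * h2

/-- Both cut values are expressed by the common value `ψ` at the vertex. After multiplication by `1
- g₃` and `1 - g₂` the results agree, because `1 - g₃²` and `1 - g₂²` differ by the factor `t²` of
the reflection. -/
theorem parallel_identity {t ψ g₂ g₃ u v x y n₁ n₂ : ℝ} (ht : t ≠ 0)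
    (hts : t ^ 2 * (1 - g₂ ^ 2) = 1 - g₃ ^ 2) (h2 : 1 - g₂ ^ 2 ≠ 0) (h3 : 1 - g₃ ^ 2 ≠ 0)
    (hu : u ≠ 0) (hx : x ≠ 0)
    (hn₁ : n₁ = u * t⁻¹ + (v - u * t⁻¹ * (g₃ - t * g₂)) * ψ)
    (hn₂ : n₂ = x * t + (y - x * t * (g₂ - t⁻¹ * g₃)) * ψ)
    (hs₁ : n₁ ^ 2 = u ^ 2 + v ^ 2 + 2 * u * v * g₂)
    (hs₂ : n₂ ^ 2 = x ^ 2 + y ^ 2 + 2 * x * y * g₃)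
    (ht₁ : v - u * t⁻¹ * (g₃ - t * g₂) = 0 → ψ = g₃)
    (ht₂ : y - x * t * (g₂ - t⁻¹ * g₃) = 0 → ψ = g₂) :
    (1 - (n₁ - v) / u) * (1 - g₃) = (1 - (n₂ - y) / x) * (1 - g₂) := by
  obtain ⟨z₁, hz₁⟩ : ∃ z, z = u * t⁻¹ := ⟨_, rfl⟩
  obtain ⟨z₂, hz₂⟩ : ∃ z, z = x * t := ⟨_, rfl⟩
  have hu' : u = z₁ * t := by rw [hz₁]; field_simp
  have hx' : x = z₂ * t⁻¹ := by rw [hz₂]; field_simp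
  have hts' : t⁻¹ ^ 2 * (1 - g₃ ^ 2) = 1 - g₂ ^ 2 := by rw [← hts]; field_simp
  obtain ⟨w₁, hw₁⟩ : ∃ w, w = v - u * t⁻¹ * (g₃ - t * g₂) := ⟨_, rfl⟩
  obtain ⟨w₂, hw₂⟩ : ∃ w, w = y - x * t * (g₂ - t⁻¹ * g₃) := ⟨_, rfl⟩
  rw [← hw₁] at ht₁ hn₁
  rw [← hw₂] at ht₂ hn₂
  rw [← hz₁] at hw₁ hn₁
  rw [← hz₂] at hw₂ hn₂
  have hz₁0 : z₁ ≠ 0 := by rw [hz₁]; positivity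
  have hz₂0 : z₂ ≠ 0 := by rw [hz₂]; positivity
  have hv : v = w₁ + z₁ * (g₃ - t * g₂) := by rw [hw₁]; ring
  have hy : y = w₂ + z₂ * (g₂ - t⁻¹ * g₃) := by rw [hw₂]; ring
  obtain ⟨h1, k₁⟩ := cut_identity (z := z₁) (w := w₁) (ψ := ψ) hz₁0 h3 (by
    rw [hn₁, hu', hv] at hs₁
    linear_combination hs₁ + z₁ ^ 2 * hts) ht₁
  obtain ⟨-, k₂⟩ := cut_identity (z := z₂) (w := w₂) (ψ := ψ) hz₂0 h2 (by
    rw [hn₂, hx', hy] at hs₂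
    linear_combination hs₂ + z₂ ^ 2 * hts') ht₂
  have e₁ : (n₁ - v) / u = g₂ + (1 + g₃) * (1 - ψ) / (1 + ψ) / t := by
    rw [hn₁, hv, hu']
    field_simp
    linear_combination k₁
  have e₂ : (n₂ - y) / x = g₃ + (1 + g₂) * (1 - ψ) / (1 + ψ) * t := by
    rw [hn₂, hy, hx']
    field_simp
    field_simp at k₂
    linear_combination t * k₂
  rw [e₁, e₂]
  field_simp
  linear_combination (1 - ψ) * hts

/-- The corners are `P`, `Q` and the mirror images of `C` and `B`, where the functional is `1`.
Changing the normalization to the value `1` at `A°` lets the cuts be compared with those of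
neighbouring vertices. -/
theorem Parallel.exists_isCut (hABC : IsClassicalTriple ρ A B C)
    (hF : NormalFrame ρ ε (unitVec ρ A) (unitVec ρ B) (unitVec ρ C))
    (hP : lift P = u • unitVec ρ A + v • unitVec ρ C)
    (hQ : lift Q = x • unitVec ρ A + y • unitVec ρ B)
    (hu : u ≠ 0) (hv : v ≠ 0) (hx : x ≠ 0) (hy : y ≠ 0)
    (h : Parallel ρ A B C (join P Q) (join B C)) :
    ∃ φ ψ, IsCut ρ ε (unitVec ρ C) (unitVec ρ A) (lift P) φ ∧
      IsCut ρ ε (unitVec ρ B) (unitVec ρ A) (lift Q) ψ ∧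
      (1 - φ) * (1 - ε * form ρ (unitVec ρ A) (unitVec ρ B)) =
        (1 - ψ) * (1 - ε * form ρ (unitVec ρ C) (unitVec ρ A)) := by
  have hA := hABC.anisotropic
  have hB := hABC.rotate.anisotropic
  have hC := hABC.rotate.rotate.anisotropic
  obtain ⟨-, ⟨-, h1, -⟩ | ⟨R, ⟨h0, h0'⟩, ⟨h1', h1⟩, ⟨h2, h2'⟩, ⟨h3', h3⟩, -, M, m, H⟩⟩ := h
  · rw [onLine_iff, join_eq hB hC] at h1
    obtain ⟨r, hr, hr'⟩ := lift_eq hA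
    rw [hr', Submodule.smul_mem_iff _ hr.ne'] at h1
    exact absurd h1 hF.notMem_span_self
  · obtain ⟨t, ht, hts, hmb, hmc⟩ := hF.mirror_eq
    have hma := NormalFrame.mirror_self (ρ := ρ) A B C
    have hmm : ∀ x, mirror ρ A B C (mirror ρ A B C x) = x := fun x => reflection_reflection _ _
    have hform : ∀ x y, form ρ (mirror ρ A B C x) (mirror ρ A B C y) = form ρ x y :=
      fun x y => form_reflection _ _ _
    obtain ⟨g₂, hg₂⟩ : ∃ g, g = ε * form ρ (unitVec ρ C) (unitVec ρ A) := ⟨_, rfl⟩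
    obtain ⟨g₃, hg₃⟩ : ∃ g, g = ε * form ρ (unitVec ρ A) (unitVec ρ B) := ⟨_, rfl⟩
    rw [← hg₂, ← hg₃] at hts hmb hmc
    rw [join_eq hC hA, Set.pair_comm] at h0 h3
    rw [join_eq hA hB] at h1 h2
    rw [join_eq hB hC] at h2' h3'
    simp only [Matrix.cons_val] at h0 h0' h1 h1' h2 h2' h3 h3'
    have hPm : lift P ∈ Submodule.span ℝ {unitVec ρ A, unitVec ρ C} :=
      Submodule.mem_span_pair.2 ⟨u, v, hP.symm⟩
    have hQm : lift Q ∈ Submodule.span ℝ {unitVec ρ A, unitVec ρ B} :=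
      Submodule.mem_span_pair.2 ⟨x, y, hQ.symm⟩
    obtain ⟨s₀, e₀⟩ := hF.exists_smul_of_mem h0 (by rw [← hQ, ← join_eq_lift]; exact h0') hPm hy
    obtain ⟨s₁, e₁⟩ := hF.swap.exists_smul_of_mem h1
      (by rw [← hP, Set.pair_comm, ← join_eq_lift]; exact h1') hQm hv
    have hmbc : Submodule.map (mirror ρ A B C) (Submodule.span ℝ {unitVec ρ B, unitVec ρ C}) =
        Submodule.span ℝ {mirror ρ A B C (unitVec ρ B), mirror ρ A B C (unitVec ρ C)} := by
      rw [Submodule.map_span, Set.image_pair]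
    have hmc' : mirror ρ A B C (unitVec ρ C) = (g₂ - t⁻¹ * g₃) • unitVec ρ A +
        t⁻¹ • unitVec ρ B := by rw [hmc, add_comm]
    have hmb' : mirror ρ A B C (unitVec ρ B) = (g₃ - t * g₂) • unitVec ρ A +
        t • unitVec ρ C := by rw [hmb, add_comm]
    rw [hmbc] at h2' h3'
    obtain ⟨s₂, e₂⟩ := hF.swap.exists_smul_of_mem (v := t) h2
      (by rw [Set.pair_comm, ← hmb']; exact h2')
      (by rw [hmc']; exact Submodule.mem_span_pair.2 ⟨_, _, rfl⟩) ht
    obtain ⟨s₃, e₃⟩ := hF.exists_smul_of_mem (v := t⁻¹) h3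
      (by rw [← hmc']; exact h3')
      (by rw [hmb']; exact Submodule.mem_span_pair.2 ⟨_, _, rfl⟩) (inv_ne_zero ht)
    have E₀ := eq_of_lift_eq_smul e₀
    have E₁ := eq_of_lift_eq_smul e₁
    have e₂' : lift (R 2) = s₂ • unitVec ρ C := by
      rw [← hmm (lift (R 2)), e₂, map_smul, hmm]
    have e₃' : lift (R 3) = s₃ • unitVec ρ B := by
      rw [← hmm (lift (R 3)), e₃, map_smul, hmm]
    rw [unitVec_eq, smul_smul] at e₂' e₃'
    have E₂ := eq_of_lift_eq_smul e₂'
    have E₃ := eq_of_lift_eq_smul e₃'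
    obtain ⟨r₃, hr₃, hB'⟩ := lift_eq hB
    obtain ⟨r₂, hr₂, hC'⟩ := lift_eq hC
    rw [E₀, E₁, E₂, E₃, hC', hB', map_smul, map_smul] at H
    obtain ⟨n, H0, H1, H2⟩ := H.exists_form_eq hF.metric_ne hF.sq (by
      simp only [Matrix.cons_val]
      rw [form_smul_left, form_smul_right, hform]
      have : ε * (r₂ * (r₂ * form ρ (unitVec ρ C) (unitVec ρ C))) = r₂ * r₂ := by
        linear_combination r₂ * r₂ * hF.cc
      rw [this]
      positivity)
    have hnC := form_eq_one hr₂ rfl (by rw [hform, hF.cc]) (H0 2) (H1 2)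
    have hnB := form_eq_one hr₃ rfl (by rw [hform, hF.bb]) (H0 3) (H1 3)
    have hP0 := H0 0
    have hP1 := H1 0
    have hQ0 := H0 1
    have hQ1 := H1 1
    have tP := H2 3
    have tQ := H2 1
    simp only [Matrix.cons_val, Fin.reduceAdd] at hP0 hP1 hQ0 hQ1 tP tQ
    have hεAC : ε * form ρ (unitVec ρ A) (unitVec ρ C) = g₂ := by rw [hg₂, form_comm]
    have hεAmb : ε * form ρ (unitVec ρ A) (mirror ρ A B C (unitVec ρ B)) = g₃ := by
      conv_lhs => rw [← hma, hform]
      exact hg₃.symm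
    have hεAmc : ε * form ρ (unitVec ρ A) (mirror ρ A B C (unitVec ρ C)) = g₂ := by
      conv_lhs => rw [← hma, hform]
      exact hεAC
    obtain ⟨ψ, hψ⟩ : ∃ ψ, ψ = form ρ n (unitVec ρ A) := ⟨_, rfl⟩
    -- The leg `CA` is described by `A°` and the mirror image of `B°`, where the functional has the
    -- values `ψ` and `1`.
    have hPe : lift P = (v * t⁻¹) • mirror ρ A B C (unitVec ρ B) +
        (u - v * t⁻¹ * (g₃ - t * g₂)) • unitVec ρ A := by
      have : v = v * t⁻¹ * t := by field_simp
      rw [hP, hmb']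
      nth_rw 1 [this]
      module
    have hQe : lift Q = (y * t) • mirror ρ A B C (unitVec ρ C) +
        (x - y * t * (g₂ - t⁻¹ * g₃)) • unitVec ρ A := by
      have : y = y * t * t⁻¹ := by field_simp
      rw [hQ, hmc']
      nth_rw 1 [this]
      module
    have key := parallel_identity (ψ := ψ) (n₁ := form ρ n (lift P)) (n₂ := form ρ n (lift Q))
      (u := v) (v := u) (x := y) (y := x)
      ht hts (hg₂ ▸ hF.ca_ne) (hg₃ ▸ hF.ab_ne) hv hy
      (by rw [hPe, form_add_right, form_smul_right, form_smul_right, hnB, hψ, mul_one])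
      (by rw [hQe, form_add_right, form_smul_right, form_smul_right, hnC, hψ, mul_one])
      (by
        rw [← hP1, hP]
        simp only [form_add_left, form_add_right, form_smul_left, form_smul_right]
        rw [form_comm ρ (unitVec ρ A) (unitVec ρ C)]
        linear_combination u ^ 2 * hF.aa + v ^ 2 * hF.cc - 2 * u * v * hg₂)
      (by
        rw [← hQ1, hQ]
        simp only [form_add_left, form_add_right, form_smul_left, form_smul_right]
        rw [form_comm ρ (unitVec ρ B) (unitVec ρ A)]
        linear_combination x ^ 2 * hF.aa + y ^ 2 * hF.bb - 2 * x * y * hg₃)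
      -- Here `P` is the mirror image of `B`, and tangency of the leg gives `ψ`; the next argument
      -- treats `Q` likewise.
      (fun h0 => by
        rw [h0, zero_smul, add_zero] at hPe
        have h4 := tP (by
          rw [hPe, Submodule.span_singleton_smul_eq (isUnit_iff_ne_zero.2 hr₃.ne'),
            Submodule.span_singleton_smul_eq (isUnit_iff_ne_zero.2 (by positivity))])
          (unitVec ρ A) (by rw [join_eq hC hA]; exact Submodule.subset_span (by simp))
        rw [form_smul_right, form_smul_right, hnB, ← hψ] at h4
        apply mul_left_cancel₀ hr₃.ne'
        linear_combination -h4 + r₃ * hεAmb)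
      (fun h0 => by
        rw [h0, zero_smul, add_zero] at hQe
        have h4 := tQ (by
          rw [hQe, Submodule.span_singleton_smul_eq (isUnit_iff_ne_zero.2 hr₂.ne'),
            Submodule.span_singleton_smul_eq (isUnit_iff_ne_zero.2 (by positivity))])
          (unitVec ρ A) (by rw [join_eq hA hB]; exact Submodule.subset_span (by simp))
        rw [hQe, form_smul_right, form_smul_right, hnC, ← hψ] at h4
        have h5 : y * t ≠ 0 := by positivity
        apply mul_left_cancel₀ h5
        linear_combination -h4 + y * t * hεAmc)
    rw [hg₂, hg₃] at key
    refine ⟨_, _, ⟨v, u, hv, hu, by rw [hP, add_comm], ?_, ?_⟩,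
      ⟨y, x, hy, hx, by rw [hQ, add_comm], ?_, ?_⟩, key⟩
    · rw [mul_div_cancel₀ _ hv, sub_add_cancel]; exact hP0
    · rw [mul_div_cancel₀ _ hv, sub_add_cancel]; exact hP1.symm
    · rw [mul_div_cancel₀ _ hy, sub_add_cancel]; exact hQ0
    · rw [mul_div_cancel₀ _ hy, sub_add_cancel]; exact hQ1.symm

end Vertex

/-! ### From equal cuts back to antiparallel lines -/

theorem linearIndependent_lift {P Q : Plane} (h : P ≠ Q) :
    LinearIndependent ℝ ![lift P, lift Q] := by
  rw [LinearIndependent.pair_iff' (lift_ne_zero P)]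
  intro r hr
  exact h (eq_of_lift_eq_smul hr.symm).symm

theorem span_lift_ne {P Q : Plane} (h : P ≠ Q) :
    Submodule.span ℝ {lift P} ≠ Submodule.span ℝ {lift Q} := by
  intro h0
  have h1 : lift P ∈ Submodule.span ℝ {lift Q} := h0 ▸ Submodule.mem_span_singleton_self _
  obtain ⟨r, hr⟩ := Submodule.mem_span_singleton.1 h1
  exact h (eq_of_lift_eq_smul hr.symm)

theorem ne_of_lift_notMem {P Q : Plane} {l : Line} (hP : lift P ∉ l) (hQ : lift Q ∈ l) :
    P ≠ Q := fun h => hP (h ▸ hQ)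

theorem NormalFrame.eps_eq_one {a b c : Fin 3 → ℝ} (h : NormalFrame ρ ε a b c) (hρ : 0 < ρ) :
    ε = 1 := by
  have h1 := h.aa
  have h2 : 0 ≤ form ρ a a := by
    rw [form_apply]
    have := mul_nonneg hρ.le (mul_self_nonneg (a 0))
    nlinarith [mul_self_nonneg (a 1), mul_self_nonneg (a 2)]
  rcases mul_self_eq_one_iff.1 h.sq with h3 | h3
  · exact h3
  · rw [h3] at h1
    linarith

/-- Inner points of a segment with ends on a branch of a circle. -/
theorem inside_circleMatrix_lift (hε : ε = 1 ∧ 0 < ρ ∨ ε = -1) {m : Fin 3 → ℝ}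
    {P Q : Plane} (hPQ : P ≠ Q) (hP : ε * form ρ (lift P) (lift P) = form ρ m (lift P) ^ 2)
    (hQ : ε * form ρ (lift Q) (lift Q) = form ρ m (lift Q) ^ 2)
    (hP0 : 0 ≤ form ρ m (lift P)) (hQ0 : 0 ≤ form ρ m (lift Q))
    {s t : ℝ} (hs : 0 < s) (ht : 0 < t) :
    Inside (circleMatrix ρ ε m) (s • lift P + t • lift Q) := by
  have hi := linearIndependent_lift hPQ
  rcases hε with ⟨rfl, hρ⟩ | rfl
  · exact inside_circleMatrix_of_pos hρ hi (by linarith) (by linarith) hP0 hQ0 hs ht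
  · refine inside_circleMatrix_of_neg hi (by linarith) (by linarith)
      (lift_pos_of_form_nonpos (ρ := ρ) P ?_) (lift_pos_of_form_nonpos (ρ := ρ) Q ?_) hs ht
    · linarith [sq_nonneg (form ρ m (lift P))]
    · linarith [sq_nonneg (form ρ m (lift Q))]

variable {A B C P Q : Plane}

/-- The center is the vector with products `φ, 1, 1` with the frame. Consecutive corners of `P, Q,
B, C` are different, so the tangency clause is void. -/
theorem antiparallel_of_isCut (hABC : IsClassicalTriple ρ A B C)
    (hF : NormalFrame ρ ε (unitVec ρ A) (unitVec ρ B) (unitVec ρ C)) {φ : ℝ}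
    (hP : IsCut ρ ε (unitVec ρ A) (unitVec ρ C) (lift P) φ)
    (hQ : IsCut ρ ε (unitVec ρ A) (unitVec ρ B) (lift Q) φ) :
    Antiparallel ρ A B C (join P Q) (join B C) := by
  have hA := hABC.anisotropic
  have hB := hABC.rotate.anisotropic
  have hC := hABC.rotate.rotate.anisotropic
  obtain ⟨u, v, hu, hv, hP, hP0, hP1⟩ := hP
  obtain ⟨x, y, hx, hy, hQ, hQ0, hQ1⟩ := hQ
  obtain ⟨rA, hrA, hA'⟩ := lift_eq hA
  obtain ⟨rB, hrB, hB'⟩ := lift_eq hB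
  obtain ⟨rC, hrC, hC'⟩ := lift_eq hC
  have hPCA : lift P ∈ join C A := by
    rw [join_eq hC hA]; exact Submodule.mem_span_pair.2 ⟨v, u, by rw [hP, add_comm]⟩
  have hQAB : lift Q ∈ join A B := by
    rw [join_eq hA hB]; exact Submodule.mem_span_pair.2 ⟨x, y, hQ.symm⟩
  have hPAB : lift P ∉ join A B := by
    rw [join_eq hA hB, hP]
    have := hF.rotate.rotate.notMem_span (u := v) (v := u) (w := 0) hv
    rwa [zero_smul, add_zero, add_comm] at this
  have hPBC : lift P ∉ join B C := by
    rw [join_eq hB hC, hP]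
    have := hF.notMem_span (u := u) (v := 0) (w := v) hu
    rwa [zero_smul, add_zero] at this
  have hQBC : lift Q ∉ join B C := by
    rw [join_eq hB hC, hQ]
    have := hF.notMem_span (u := x) (v := y) (w := 0) hx
    rwa [zero_smul, add_zero] at this
  have memJ : ∀ X Y : Plane, lift X ∈ join X Y ∧ lift Y ∈ join X Y := fun X Y => by
    rw [join_eq_lift]
    exact ⟨Submodule.subset_span (by simp), Submodule.subset_span (by simp)⟩
  have hABC' : lift A ∉ join B C := by
    rw [join_eq hB hC, hA', Submodule.smul_mem_iff _ hrA.ne']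
    exact hF.notMem_span_self
  have hBCA' : lift B ∉ join C A := by
    rw [join_eq hC hA, hB', Submodule.smul_mem_iff _ hrB.ne']
    exact hF.rotate.notMem_span_self
  have hAPQ : lift A ∉ join P Q := by
    rw [join_eq_lift, hP, hQ]
    intro h0
    obtain ⟨s, t, hst⟩ := Submodule.mem_span_pair.1 h0
    have h1 := hF.coord_eq_zero (u := s * u + t * x - rA) (v := t * y) (w := s * v) (by
      rw [hA', ← sub_eq_zero] at hst
      rw [← hst]
      module)
    have h2 := (mul_eq_zero.1 h1.2.1).resolve_right hy
    have h3 := (mul_eq_zero.1 h1.2.2).resolve_right hv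
    rw [h2, h3] at h1
    linarith [h1.1]
  have nPQ : P ≠ Q := ne_of_lift_notMem hPAB hQAB
  have nQB : Q ≠ B := ne_of_lift_notMem hQBC (memJ B C).1
  have nPB : P ≠ B := ne_of_lift_notMem hPBC (memJ B C).1
  have nBC : B ≠ C := ne_of_lift_notMem hBCA' (memJ C A).1
  have nCP : C ≠ P := (ne_of_lift_notMem hPBC (memJ B C).2).symm
  refine ⟨?_, Or.inr ⟨![P, Q, B, C], ?_⟩⟩
  · rw [Set.ncard_insert_of_notMem, Set.ncard_insert_of_notMem, Set.ncard_pair]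
    · exact fun h => hPBC (h ▸ (memJ P Q).1)
    · rintro (h | h)
      · exact hAPQ (h ▸ (memJ A B).1)
      · exact hABC' (h ▸ (memJ A B).1)
    · rintro (h | h | h)
      · exact hBCA' (h.symm ▸ (memJ A B).2)
      · exact hAPQ (h ▸ (memJ C A).2)
      · exact hABC' (h ▸ (memJ C A).2)
  · obtain ⟨m, hm⟩ : ∃ m, m = vecOfDual ρ A B C ![φ, 1, 1] := ⟨_, rfl⟩
    have hmA : form ρ m (unitVec ρ A) = φ := hm ▸ hF.form_vecOfDual ![φ, 1, 1] 0
    have hmB : form ρ m (unitVec ρ B) = 1 := hm ▸ hF.form_vecOfDual ![φ, 1, 1] 1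
    have hmC : form ρ m (unitVec ρ C) = 1 := hm ▸ hF.form_vecOfDual ![φ, 1, 1] 2
    have hm0 : m ≠ 0 := by
      intro h0
      rw [h0, form_zero_left] at hmB
      exact zero_ne_one hmB
    have eP : form ρ m (lift P) = u * φ + v := by
      rw [hP, form_add_right, form_smul_right, form_smul_right, hmA, hmC, mul_one]
    have eQ : form ρ m (lift Q) = x * φ + y := by
      rw [hQ, form_add_right, form_smul_right, form_smul_right, hmA, hmB, mul_one]
    have eB : form ρ m (lift B) = rB := by rw [hB', form_smul_right, hmB, mul_one]
    have eC : form ρ m (lift C) = rC := by rw [hC', form_smul_right, hmC, mul_one]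
    have H : ∀ i, 0 ≤ form ρ m (lift (![P, Q, B, C] i)) ∧
        ε * form ρ (lift (![P, Q, B, C] i)) (lift (![P, Q, B, C] i)) =
          form ρ m (lift (![P, Q, B, C] i)) ^ 2 := by
      intro i
      fin_cases i
      · exact ⟨by rw [← eP] at hP0; exact hP0, by rw [← eP] at hP1; exact hP1.symm⟩
      · exact ⟨by rw [← eQ] at hQ0; exact hQ0, by rw [← eQ] at hQ1; exact hQ1.symm⟩
      · refine ⟨eB.symm ▸ hrB.le, ?_⟩
        change ε * form ρ (lift B) (lift B) = form ρ m (lift B) ^ 2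
        rw [eB, hB', form_smul_left, form_smul_right]
        linear_combination rB ^ 2 * hF.bb
      · refine ⟨eC.symm ▸ hrC.le, ?_⟩
        change ε * form ρ (lift C) (lift C) = form ρ m (lift C) ^ 2
        rw [eC, hC', form_smul_left, form_smul_right]
        linear_combination rC ^ 2 * hF.cc
    have hne : ∀ i : Fin 4, ![P, Q, B, C] i ≠ ![P, Q, B, C] (i + 1) := by
      intro i
      fin_cases i <;> assumption
    refine ⟨⟨hPCA, (memJ P Q).1⟩, ⟨(memJ P Q).2, hQAB⟩, ⟨(memJ A B).2, (memJ B C).1⟩,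
      ⟨(memJ B C).2, (memJ C A).1⟩, ?_, circleMatrix ρ ε m, m,
      ⟨isCircle_circleMatrix hF.metric_ne hF.sq hm0 (H 0).2 (H 1).2 (linearIndependent_lift nPQ),
        fun i => ?_, fun i => (H i).1, fun i hi => absurd hi (span_lift_ne (hne i)),
        fun hin i _ s t hs ht => ?_⟩⟩
    · have h3 : ({Submodule.span ℝ {lift P}, Submodule.span ℝ {lift B},
          Submodule.span ℝ {lift C}} : Set (Submodule ℝ (Fin 3 → ℝ))).ncard = 3 := by
        rw [Set.ncard_insert_of_notMem, Set.ncard_pair (span_lift_ne nBC)]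
        rintro (h | h)
        · exact span_lift_ne nPB h
        · exact span_lift_ne nCP.symm h
      refine h3.symm.le.trans (Set.ncard_le_ncard ?_ (Set.finite_range _))
      rintro _ (rfl | rfl | rfl)
      · exact ⟨0, rfl⟩
      · exact ⟨2, rfl⟩
      · exact ⟨3, rfl⟩
    · rw [dotProduct_circleMatrix, (H i).2]; ring
    · refine inside_circleMatrix_lift ?_ (hne i) (H i).2 (H (i + 1)).2 (H i).1 (H (i + 1)).1 hs ht
      -- The elliptic case forces `ε = 1`, a vertex inside the absolute conic forces `ε = -1`.
      rcases hin with h | h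
      · exact Or.inl ⟨hF.eps_eq_one h, h⟩
      · rcases mul_self_eq_one_iff.1 hF.sq with h1 | h1
        · have h2 := hF.aa
          rw [← form_lift, hA', form_smul_left, form_smul_right] at h
          rw [h1, one_mul] at h2
          rw [h2] at h
          exact absurd h (by nlinarith)
        · exact Or.inr h1

/-! ### The Tucker circle -/

namespace IsCut

variable {X Y p : Fin 3 → ℝ} {φ g : ℝ}

/-- Being a nonnegative root of a given number, the value at `p` is determined, and `u ≠ 0` then
determines `φ`. This links consecutive conditions of the hexagon. -/
theorem unique {a b c : Fin 3 → ℝ} (hF : NormalFrame ρ ε a b c) {φ ψ : ℝ}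
    (h₁ : IsCut ρ ε a b p φ) (h₂ : IsCut ρ ε a b p ψ) : φ = ψ := by
  obtain ⟨u, v, hu, hv, hp, h0, h1⟩ := h₁
  obtain ⟨u', v', hu', hv', hp', h0', h1'⟩ := h₂
  obtain ⟨rfl, rfl⟩ := hF.pair_coord (hp.symm.trans hp')
  have h2 : u * φ + v = u * ψ + v := by
    rw [← pow_left_inj₀ h0 h0' two_ne_zero, h1, h1']
  exact mul_left_cancel₀ hu (by linarith)

theorem coord_relation (hX : ε * form ρ X X = 1) (hY : ε * form ρ Y Y = 1)
    (hg : ε * form ρ X Y = g) (h : IsCut ρ ε X Y p φ) :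
    ∃ u v : ℝ, u ≠ 0 ∧ v ≠ 0 ∧ p = u • X + v • Y ∧ 0 ≤ u * φ + v ∧
      (u * φ + v) ^ 2 = ε * form ρ p p ∧ u * (1 - φ ^ 2) = 2 * v * (φ - g) := by
  obtain ⟨u, v, hu, hv, hp, h0, h1⟩ := h
  refine ⟨u, v, hu, hv, hp, h0, h1, ?_⟩
  rw [hp] at h1
  simp only [form_add_left, form_add_right, form_smul_left, form_smul_right, form_comm ρ Y X] at h1
  apply mul_left_cancel₀ hu
  linear_combination -(u ^ 2 * hX + v ^ 2 * hY + 2 * u * v * hg) - h1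

end IsCut

section Side

variable {a b c p q : Fin 3 → ℝ} {lam k x y : ℝ}

/-- A cut of a side in terms of the parameter of a Tucker hexagon. -/
theorem IsCut.tucker_relation (hF : NormalFrame ρ ε a b c) (hg : ε * form ρ a b = 1 - k)
    (h : IsCut ρ ε a b p (1 - lam * k * y)) :
    lam ≠ 0 ∧ 1 - lam * y ≠ 0 ∧ ∃ u v : ℝ, u ≠ 0 ∧ v ≠ 0 ∧ p = u • a + v • b ∧
      0 ≤ u * (1 - lam * k * y) + v ∧ (u * (1 - lam * k * y) + v) ^ 2 = ε * form ρ p p ∧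
      u * (lam * y * (2 - lam * k * y)) = 2 * v * (1 - lam * y) := by
  obtain ⟨u, v, hu, hv, hp, h0, h1, h2⟩ := h.coord_relation hF.aa hF.bb hg
  have hk : k * (2 - k) ≠ 0 := by
    have := hF.ab_ne
    rw [hg] at this
    convert! this using 1
    ring
  have hk0 : k ≠ 0 := left_ne_zero_of_mul hk
  have h3 : u * (lam * y * (2 - lam * k * y)) = 2 * v * (1 - lam * y) := by
    apply mul_left_cancel₀ hk0
    linear_combination h2
  refine ⟨?_, ?_, u, v, hu, hv, hp, h0, h1, h3⟩
  · rintro rfl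
    exact hv (by linarith)
  · intro h4
    have h5 : lam * y = 1 := by linarith
    rw [h4, mul_zero] at h3
    have h6 := (mul_eq_zero.1 h3).resolve_left hu
    -- This contradicts `k * (2 - k) ≠ 0`, the Gram determinant of the side.
    have h7 : 2 - k = 0 := by linear_combination h6 + (-2 + k * (lam * y) + k) * h5
    exact right_ne_zero_of_mul hk h7

/-- The Tucker functional and that of the cut differ on the side but agree at `p`, by the relation
between its coordinates. In the application `k` belongs to this side, `y` to the other side through
`a`, `x` to the other side through `b`. -/
theorem IsCut.on_circle {m : Fin 3 → ℝ} (hF : NormalFrame ρ ε a b c)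
    (hg : ε * form ρ a b = 1 - k) (h : IsCut ρ ε a b p (1 - lam * k * y))
    (hμ : 2 - lam ^ 2 * (k * x * y) ≠ 0)
    (ha : (2 - lam ^ 2 * (k * x * y)) * form ρ m a =
      2 + lam ^ 2 * (k * x * y) - 2 * lam * (k * y))
    (hb : (2 - lam ^ 2 * (k * x * y)) * form ρ m b =
      2 + lam ^ 2 * (k * x * y) - 2 * lam * (k * x)) :
    0 ≤ form ρ m p ∧ ε * form ρ p p = form ρ m p ^ 2 := by
  obtain ⟨-, hy, u, v, hu, hv, hp, h0, h1, h2⟩ := h.tucker_relation hF hg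
  have h3 : form ρ m p = u * (1 - lam * k * y) + v := by
    rw [hp, form_add_right, form_smul_right, form_smul_right]
    apply mul_left_cancel₀ hμ
    apply mul_left_cancel₀ hy
    linear_combination (1 - lam * y) * u * ha + (1 - lam * y) * v * hb -
      lam * k * x * (lam * y - 1) * h2
  exact ⟨h3 ▸ h0, by rw [h3, h1]⟩

theorem IsCut.form_relation {e : Fin 3 → ℝ} (hF : NormalFrame ρ ε a b c)
    (hg : ε * form ρ a b = 1 - k) (h : IsCut ρ ε a b p (1 - lam * k * y))
    (he : form ρ e p = 0) :
    2 * (1 - lam * y) * form ρ e a + lam * y * (2 - lam * k * y) * form ρ e b = 0 := by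
  obtain ⟨-, -, u, v, hu, hv, hp, -, -, h2⟩ := h.tucker_relation hF hg
  rw [hp, form_add_right, form_smul_right, form_smul_right] at he
  apply (mul_eq_zero.1 _).resolve_left hu
  linear_combination 2 * (1 - lam * y) * he + form ρ e b * h2

/-- In the exceptional case the coordinates become proportional, so the two points of a side
coincide. Comparing the norm as given by the two cuts then forces it to vanish. -/
theorem isotropic_of_isCut {P Q : Plane} (hF : NormalFrame ρ ε a b c)
    (hg : ε * form ρ a b = 1 - k) (hP : IsCut ρ ε a b (lift P) (1 - lam * k * y))
    (hQ : IsCut ρ ε b a (lift Q) (1 - lam * k * x))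
    (hμ : 2 - lam ^ 2 * (k * x * y) = 0) : pointSign ρ P = 0 ∧ pointSign ρ Q = 0 := by
  obtain ⟨hl, hy, u, v, hu, hv, hp, h0, h1, h2⟩ := hP.tucker_relation hF hg
  obtain ⟨-, hx, u', v', hu', hv', hq, h0', h1', h2'⟩ :=
    hQ.tucker_relation hF.rotate.swap (by rw [form_comm]; exact hg)
  have hx0 : x ≠ 0 := by rintro rfl; norm_num at hμ
  have hy0 : y ≠ 0 := by rintro rfl; norm_num at hμ
  have hk0 : k ≠ 0 := by rintro rfl; norm_num at hμ
  have e1 : u * (y * (lam * x - 1)) = v * (x * (1 - lam * y)) := by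
    linear_combination x / 2 * h2 - u * y / 2 * hμ
  have e2 : u' * (x * (lam * y - 1)) = v' * (y * (1 - lam * x)) := by
    linear_combination y / 2 * h2' - u' * x / 2 * hμ
  have hx1 : lam * x - 1 ≠ 0 := by rw [← neg_ne_zero, neg_sub]; exact hx
  have h3 : u * u' = v * v' := by
    have : y * (lam * x - 1) ≠ 0 := mul_ne_zero hy0 hx1
    apply mul_left_cancel₀ this
    linear_combination u' * e1 - v * e2
  have hPQ : P = Q := by
    refine eq_of_lift_eq_smul (r := u / v') ?_
    rw [hp, hq, smul_add, smul_smul, smul_smul, div_mul_cancel₀ _ hv', div_mul_eq_mul_div, h3,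
      mul_div_cancel_right₀ _ hv', add_comm]
  rw [hPQ] at hp h1
  obtain ⟨rfl, rfl⟩ := hF.pair_coord (hp.symm.trans (hq.trans (add_comm _ _)))
  have h4 : u * (1 - lam * k * y) + v = v * (1 - lam * k * x) + u := by
    rw [← pow_left_inj₀ h0 h0' two_ne_zero, h1, h1']
  have h5 : u * y = v * x := by
    apply mul_left_cancel₀ (mul_ne_zero hl hk0)
    linear_combination -h4
  have h6 : lam * (x + y) = 2 := by
    have : u * y ≠ 0 := mul_ne_zero hu hy0
    apply mul_left_cancel₀ this
    linear_combination e1 - (1 - lam * y) * h5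
  have h7 : u * (1 - lam * k * y) + v = 0 := by
    apply mul_left_cancel₀ (mul_ne_zero hl hx0)
    linear_combination u * h6 + u * hμ - lam * h5
  rw [h7] at h1
  have hε0 : ε ≠ 0 := left_ne_zero_of_mul (hF.sq ▸ one_ne_zero)
  have h8 : form ρ (lift Q) (lift Q) = 0 :=
    (mul_eq_zero.1 (h1.symm.trans (by norm_num))).resolve_left hε0
  have h9 : pointSign ρ Q = 0 := by
    rw [pointSign, ← form_lift, h8, sign_zero]
  exact ⟨hPQ ▸ h9, h9⟩

end Side

/-- Six points on the sides, two on each side, on which only the zero functional vanishes. -/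
theorem hexagon_nondegenerate {lam h₁ h₂ h₃ e₁ e₂ e₃ : ℝ} (hl : lam ≠ 0)
    (hμ : 2 - lam ^ 2 * (h₁ * h₂ * h₃) ≠ 0)
    (n₁ : 1 - lam * h₁ ≠ 0) (n₂ : 1 - lam * h₂ ≠ 0) (n₃ : 1 - lam * h₃ ≠ 0)
    (h12 : 2 * (1 - lam * h₂) * e₁ + lam * h₂ * (2 - lam * h₃ * h₂) * e₂ = 0)
    (h21 : 2 * (1 - lam * h₁) * e₂ + lam * h₁ * (2 - lam * h₃ * h₁) * e₁ = 0)
    (h23 : 2 * (1 - lam * h₃) * e₂ + lam * h₃ * (2 - lam * h₁ * h₃) * e₃ = 0)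
    (h32 : 2 * (1 - lam * h₂) * e₃ + lam * h₂ * (2 - lam * h₁ * h₂) * e₂ = 0)
    (h13 : 2 * (1 - lam * h₃) * e₁ + lam * h₃ * (2 - lam * h₂ * h₃) * e₃ = 0)
    (h31 : 2 * (1 - lam * h₁) * e₃ + lam * h₁ * (2 - lam * h₂ * h₁) * e₁ = 0) :
    e₁ = 0 ∧ e₂ = 0 ∧ e₃ = 0 := by
  -- The determinant of the two equations of a side is the nonzero factor from `hμ` times this
  -- bracket.
  have d12 : e₁ * (2 + lam ^ 2 * (h₁ * h₂ * h₃) - 2 * lam * (h₁ + h₂)) = 0 := by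
    apply mul_left_cancel₀ hμ
    linear_combination 2 * (1 - lam * h₁) * h12 - lam * h₂ * (2 - lam * h₃ * h₂) * h21
  have d13 : e₁ * (2 + lam ^ 2 * (h₁ * h₂ * h₃) - 2 * lam * (h₁ + h₃)) = 0 := by
    apply mul_left_cancel₀ hμ
    linear_combination 2 * (1 - lam * h₁) * h13 - lam * h₃ * (2 - lam * h₂ * h₃) * h31
  have d23 : e₂ * (2 + lam ^ 2 * (h₁ * h₂ * h₃) - 2 * lam * (h₂ + h₃)) = 0 := by
    apply mul_left_cancel₀ hμ
    linear_combination 2 * (1 - lam * h₂) * h23 - lam * h₃ * (2 - lam * h₁ * h₃) * h32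
  by_cases he : e₁ = 0
  · rw [he, mul_zero, add_zero] at h21 h31
    refine ⟨he, ?_, ?_⟩
    · exact (mul_eq_zero.1 h21).resolve_left (mul_ne_zero two_ne_zero n₁)
    · exact (mul_eq_zero.1 h31).resolve_left (mul_ne_zero two_ne_zero n₁)
  -- All three brackets vanish, so the `hᵢ` are equal. Then the values at any two vertices add up to
  -- zero, which is impossible for three nonzero values.
  · exfalso
    have he2 : e₂ ≠ 0 := by
      intro h0
      rw [h0, mul_zero, add_zero] at h12
      exact he ((mul_eq_zero.1 h12).resolve_left (mul_ne_zero two_ne_zero n₂))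
    have k12 := (mul_eq_zero.1 d12).resolve_left he
    have k13 := (mul_eq_zero.1 d13).resolve_left he
    have k23 := (mul_eq_zero.1 d23).resolve_left he2
    obtain rfl : h₂ = h₃ := by
      apply mul_left_cancel₀ hl
      linarith
    obtain rfl : h₁ = h₂ := by
      apply mul_left_cancel₀ hl
      linarith
    have f : lam * h₁ * (2 - lam * h₁ * h₁) = 2 * (1 - lam * h₁) := by linear_combination -k12
    rw [f] at h12 h13 h23
    have n : 2 * (1 - lam * h₁) ≠ 0 := mul_ne_zero two_ne_zero n₁
    have s12 : e₁ + e₂ = 0 := mul_left_cancel₀ n (by linear_combination h12)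
    have s13 : e₁ + e₃ = 0 := mul_left_cancel₀ n (by linear_combination h13)
    have s23 : e₂ + e₃ = 0 := mul_left_cancel₀ n (by linear_combination h23)
    exact he (by linarith)

/-! ### The center on the line `O ∨ K` -/

section Center

variable {A B C : Plane} {h₁ h₂ h₃ : ℝ}

/-- The symmedian in terms of the quantities `hᵢ = 1 - ε ⟨·, ·⟩`. -/
theorem NormalFrame.symmedian_eq
    (hF : NormalFrame ρ ε (unitVec ρ A) (unitVec ρ B) (unitVec ρ C))
    (hg₁ : ε * form ρ (unitVec ρ B) (unitVec ρ C) = 1 - h₁)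
    (hg₂ : ε * form ρ (unitVec ρ C) (unitVec ρ A) = 1 - h₂)
    (hg₃ : ε * form ρ (unitVec ρ A) (unitVec ρ B) = 1 - h₃) :
    ∃ δ : ℝ, δ ≠ 0 ∧ symmedian ρ A B C =
      δ • ((2 * (h₁ + h₂ + h₃) - (h₁ ^ 2 + h₂ ^ 2 + h₃ ^ 2) - h₁ * h₂ * h₃) •
        circumcenter ρ A B C +
      (h₁ + h₂ + h₃ - 4) • vecOfDual ρ A B C ![h₂ * h₃, h₁ * h₃, h₁ * h₂]) := by
  obtain ⟨δ, hδ, d1, d2, d3⟩ := hF.dualGram_diag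
  have e2 : ε ^ 2 = 1 := by rw [pow_two]; exact hF.sq
  have hε0 : ε ≠ 0 := left_ne_zero_of_mul (hF.sq ▸ one_ne_zero)
  refine ⟨δ * ε, mul_ne_zero hδ hε0, ?_⟩
  rw [hF.symmedian_eq_vecOfDual, circumcenter_eq_vecOfDual, ← vecOfDual_smul, ← vecOfDual_smul, ← vecOfDual_add,
    ← vecOfDual_smul]
  congr 1
  have haa : form ρ (unitVec ρ A) (unitVec ρ A) = ε := by
    linear_combination ε * hF.aa - form ρ (unitVec ρ A) (unitVec ρ A) * e2
  have hbb : form ρ (unitVec ρ B) (unitVec ρ B) = ε := by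
    linear_combination ε * hF.bb - form ρ (unitVec ρ B) (unitVec ρ B) * e2
  have hcc : form ρ (unitVec ρ C) (unitVec ρ C) = ε := by
    linear_combination ε * hF.cc - form ρ (unitVec ρ C) (unitVec ρ C) * e2
  have hbc : form ρ (unitVec ρ B) (unitVec ρ C) = ε * (1 - h₁) := by
    linear_combination ε * hg₁ - form ρ (unitVec ρ B) (unitVec ρ C) * e2
  have hca : form ρ (unitVec ρ C) (unitVec ρ A) = ε * (1 - h₂) := by
    linear_combination ε * hg₂ - form ρ (unitVec ρ C) (unitVec ρ A) * e2
  have hab : form ρ (unitVec ρ A) (unitVec ρ B) = ε * (1 - h₃) := by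
    linear_combination ε * hg₃ - form ρ (unitVec ρ A) (unitVec ρ B) * e2
  rw [hg₁] at d1
  rw [hg₂] at d2
  rw [hg₃] at d3
  ext i
  fin_cases i
  · simp only [Fin.zero_eta, gram, Matrix.mulVec, dotProduct, Fin.sum_univ_three, frame,
      Matrix.of_apply, Matrix.cons_val, Pi.smul_apply, Pi.add_apply, Pi.one_apply, smul_eq_mul,
      d1, d2, d3, haa, hab, form_comm ρ (unitVec ρ A) (unitVec ρ C), hca]
    ring
  · simp only [Fin.mk_one, gram, Matrix.mulVec, dotProduct, Fin.sum_univ_three, frame,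
      Matrix.of_apply, Matrix.cons_val, Pi.smul_apply, Pi.add_apply, Pi.one_apply, smul_eq_mul,
      d1, d2, d3, hbb, hbc, form_comm ρ (unitVec ρ B) (unitVec ρ A), hab]
    ring
  · simp only [Fin.reduceFinMk, gram, Matrix.mulVec, dotProduct, Fin.sum_univ_three, frame,
      Matrix.of_apply, Matrix.cons_val, Pi.smul_apply, Pi.add_apply, Pi.one_apply, smul_eq_mul,
      d1, d2, d3, hcc, hca, form_comm ρ (unitVec ρ C) (unitVec ρ B), hbc]
    ring

theorem NormalFrame.symmedian_ne_zero
    (hF : NormalFrame ρ ε (unitVec ρ A) (unitVec ρ B) (unitVec ρ C)) :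
    symmedian ρ A B C ≠ 0 := by
  obtain ⟨δ, hδ, d1, -, -⟩ := hF.dualGram_diag
  intro h0
  have h1 := (hF.coord_eq_zero (u := dualGram ρ A B C 0 0) (v := dualGram ρ A B C 1 1)
    (w := dualGram ρ A B C 2 2)
    (by rw [← h0]; simp [symmedian, Fin.sum_univ_three, frame])).1
  rw [d1] at h1
  exact mul_ne_zero hδ hF.bc_ne h1

theorem NormalFrame.vecOfDual_mem_span
    (hF : NormalFrame ρ ε (unitVec ρ A) (unitVec ρ B) (unitVec ρ C))
    (hg₁ : ε * form ρ (unitVec ρ B) (unitVec ρ C) = 1 - h₁)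
    (hg₂ : ε * form ρ (unitVec ρ C) (unitVec ρ A) = 1 - h₂)
    (hg₃ : ε * form ρ (unitVec ρ A) (unitVec ρ B) = 1 - h₃)
    (hOK : Submodule.span ℝ {circumcenter ρ A B C} ≠ Submodule.span ℝ {symmedian ρ A B C}) :
    vecOfDual ρ A B C ![h₂ * h₃, h₁ * h₃, h₁ * h₂] ∈
      Submodule.span ℝ {circumcenter ρ A B C, symmedian ρ A B C} := by
  obtain ⟨δ, hδ, hK⟩ := hF.symmedian_eq hg₁ hg₂ hg₃
  have hK0 := hF.symmedian_ne_zero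
  generalize 2 * (h₁ + h₂ + h₃) - (h₁ ^ 2 + h₂ ^ 2 + h₃ ^ 2) - h₁ * h₂ * h₃ = r at hK
  generalize h₁ + h₂ + h₃ - 4 = s at hK
  generalize vecOfDual ρ A B C ![h₂ * h₃, h₁ * h₃, h₁ * h₂] = W at hK ⊢
  -- If the coefficient of `W` vanished, `K` would coincide with `O`.
  have hs : s ≠ 0 := by
    rintro rfl
    rw [zero_smul, add_zero, smul_smul] at hK
    have hr : δ * r ≠ 0 := by
      intro h0
      rw [h0, zero_smul] at hK
      exact hK0 hK
    rw [hK, Submodule.span_singleton_smul_eq (isUnit_iff_ne_zero.2 hr)] at hOK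
    exact hOK rfl
  refine Submodule.mem_span_pair.2 ⟨-r / s, (δ * s)⁻¹, ?_⟩
  rw [hK]
  match_scalars
  · field_simp
    ring
  · field_simp

end Center

end CayleyKlein

/-! ### The hexagon closes and has a Tucker circle -/

open CayleyKlein in
theorem mainTheorem1 (ρ : ℝ) (hρ : ρ ≠ 0) (A B C : CayleyKlein.Plane)
    (hABC : CayleyKlein.IsClassicalTriple ρ A B C)
    (P₁ Q₂ P₃ Q₁ P₂ Q₃ : CayleyKlein.Plane)
    (hP₁ : CayleyKlein.OnLine P₁ (CayleyKlein.join B C))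
    (hQ₂ : CayleyKlein.OnLine Q₂ (CayleyKlein.join C A))
    (hP₃ : CayleyKlein.OnLine P₃ (CayleyKlein.join A B))
    (hQ₁ : CayleyKlein.OnLine Q₁ (CayleyKlein.join B C))
    (hP₂ : CayleyKlein.OnLine P₂ (CayleyKlein.join C A))
    (hQ₃ : CayleyKlein.OnLine Q₃ (CayleyKlein.join A B))
    (hvertex : ∀ P ∈ ({P₁, Q₂, P₃, Q₁, P₂, Q₃} : Set CayleyKlein.Plane),
      P ≠ A ∧ P ≠ B ∧ P ≠ C)
    (haniso : ∃ P ∈ ({P₁, Q₂, P₃, Q₁, P₂, Q₃} : Set CayleyKlein.Plane),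
      CayleyKlein.pointSign ρ P ≠ 0)
    (h₁ : CayleyKlein.Parallel ρ C A B (CayleyKlein.join P₁ Q₂) (CayleyKlein.join A B))
    (h₂ : CayleyKlein.Antiparallel ρ A B C (CayleyKlein.join Q₂ P₃) (CayleyKlein.join B C))
    (h₃ : CayleyKlein.Parallel ρ B C A (CayleyKlein.join P₃ Q₁) (CayleyKlein.join C A))
    (h₄ : CayleyKlein.Antiparallel ρ C A B (CayleyKlein.join Q₁ P₂) (CayleyKlein.join A B))
    (h₅ : CayleyKlein.Parallel ρ A B C (CayleyKlein.join P₂ Q₃) (CayleyKlein.join B C)) :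
    CayleyKlein.Antiparallel ρ B C A (CayleyKlein.join Q₃ P₁) (CayleyKlein.join C A) ∧
    (∃ M T, CayleyKlein.OnCircle ρ M T {P₁, Q₂, P₃, Q₁, P₂, Q₃}) ∧
    (∀ M T, CayleyKlein.OnCircle ρ M T {P₁, Q₂, P₃, Q₁, P₂, Q₃} →
      Submodule.span ℝ {CayleyKlein.circumcenter ρ A B C} ≠
        Submodule.span ℝ {CayleyKlein.symmedian ρ A B C} →
      T ∈ Submodule.span ℝ
        {CayleyKlein.circumcenter ρ A B C, CayleyKlein.symmedian ρ A B C}) := by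
  obtain ⟨ε, hF⟩ : ∃ ε : ℝ, NormalFrame ρ ε (unitVec ρ A) (unitVec ρ B) (unitVec ρ C) :=
    ⟨_, hABC.normalFrame hρ⟩
  have hA := hABC.anisotropic
  have hB := hABC.rotate.anisotropic
  have hC := hABC.rotate.rotate.anisotropic
  have v₁ := hvertex P₁ (by simp)
  have v₂ := hvertex Q₂ (by simp)
  have v₃ := hvertex P₃ (by simp)
  have v₄ := hvertex Q₁ (by simp)
  have v₅ := hvertex P₂ (by simp)
  have v₆ := hvertex Q₃ (by simp)
  obtain ⟨p₁, p₁', np₁, np₁', ep₁⟩ := exists_lift_eq hB hC hP₁ v₁.2.1 v₁.2.2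
  obtain ⟨q₂, q₂', nq₂, nq₂', eq₂⟩ := exists_lift_eq hC hA hQ₂ v₂.2.2 v₂.1
  obtain ⟨p₃, p₃', np₃, np₃', ep₃⟩ := exists_lift_eq hA hB hP₃ v₃.1 v₃.2.1
  obtain ⟨q₁, q₁', nq₁, nq₁', eq₁⟩ := exists_lift_eq hB hC hQ₁ v₄.2.1 v₄.2.2
  obtain ⟨p₂, p₂', np₂, np₂', ep₂⟩ := exists_lift_eq hC hA hP₂ v₅.2.2 v₅.1
  obtain ⟨q₃, q₃', nq₃, nq₃', eq₃⟩ := exists_lift_eq hA hB hQ₃ v₆.1 v₆.2.1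
  obtain ⟨φ₁, ψ₁, c₁, c₂, r₁⟩ := h₁.exists_isCut hABC.rotate.rotate hF.rotate.rotate
    (by rw [ep₁, add_comm]) eq₂ np₁' np₁ nq₂ nq₂'
  obtain ⟨φ₂, c₂', c₃⟩ := h₂.exists_isCut hABC hF (by rw [eq₂, add_comm]) ep₃ nq₂' nq₂ np₃ np₃'
  obtain ⟨φ₃, ψ₃, c₃', c₄, r₃⟩ := h₃.exists_isCut hABC.rotate hF.rotate
    (by rw [ep₃, add_comm]) eq₁ np₃' np₃ nq₁ nq₁'
  obtain ⟨φ₄, c₄', c₅⟩ := h₄.exists_isCut hABC.rotate.rotate hF.rotate.rotate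
    (by rw [eq₁, add_comm]) ep₂ nq₁' nq₁ np₂ np₂'
  obtain ⟨φ₅, ψ₅, c₅', c₆, r₅⟩ := h₅.exists_isCut hABC hF
    (by rw [ep₂, add_comm]) eq₃ np₂' np₂ nq₃ nq₃'
  have u₁ := c₂.unique hF.swap c₂'
  have u₂ := c₃.unique hF c₃'
  have u₃ := c₄.unique hF.rotate.rotate.swap c₄'
  have u₄ := c₅.unique hF.rotate.rotate c₅'
  obtain ⟨s₁, hs₁⟩ : ∃ s, ε * form ρ (unitVec ρ B) (unitVec ρ C) = 1 - s :=
    ⟨_, (sub_sub_cancel _ _).symm⟩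
  obtain ⟨s₂, hs₂⟩ : ∃ s, ε * form ρ (unitVec ρ C) (unitVec ρ A) = 1 - s :=
    ⟨_, (sub_sub_cancel _ _).symm⟩
  obtain ⟨s₃, hs₃⟩ : ∃ s, ε * form ρ (unitVec ρ A) (unitVec ρ B) = 1 - s :=
    ⟨_, (sub_sub_cancel _ _).symm⟩
  have hs₁' : ε * form ρ (unitVec ρ C) (unitVec ρ B) = 1 - s₁ := by rw [form_comm, hs₁]
  have hs₂' : ε * form ρ (unitVec ρ A) (unitVec ρ C) = 1 - s₂ := by rw [form_comm, hs₂]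
  have hs₃' : ε * form ρ (unitVec ρ B) (unitVec ρ A) = 1 - s₃ := by rw [form_comm, hs₃]
  have n₂ : s₂ ≠ 0 := by
    rintro rfl
    exact hF.ca_ne (by rw [hs₂]; norm_num)
  have n₃ : s₃ ≠ 0 := by
    rintro rfl
    exact hF.ab_ne (by rw [hs₃]; norm_num)
  rw [hs₁, hs₂, sub_sub_cancel, sub_sub_cancel] at r₁
  rw [hs₁, hs₃, sub_sub_cancel, sub_sub_cancel] at r₃
  rw [hs₂, hs₃, sub_sub_cancel, sub_sub_cancel] at r₅
  -- The Tucker parameter is read off at `A`; the remaining conditions carry it to the other cuts.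
  obtain ⟨lam, hlam⟩ : ∃ lam, φ₂ = 1 - lam * (s₂ * s₃) :=
    ⟨(1 - φ₂) / (s₂ * s₃), by field_simp; ring⟩
  have e₁ : φ₁ = 1 - lam * s₁ * s₃ := by
    apply mul_left_cancel₀ n₂
    linear_combination -r₁ + s₁ * u₁ + s₁ * hlam
  have e₂ : ψ₁ = 1 - lam * s₂ * s₃ := by rw [u₁, hlam, mul_assoc]
  have e₃ : φ₂ = 1 - lam * s₃ * s₂ := by rw [hlam]; ring
  have e₄ : ψ₃ = 1 - lam * s₁ * s₂ := by
    apply mul_left_cancel₀ n₃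
    linear_combination r₃ - s₁ * u₂ + s₁ * hlam
  have e₅ : φ₄ = 1 - lam * s₂ * s₁ := by rw [← u₃, e₄]; ring
  have e₆ : ψ₅ = 1 - lam * s₃ * s₁ := by
    apply mul_left_cancel₀ n₂
    linear_combination r₅ - s₃ * u₄ + s₃ * e₅
  rw [e₁] at c₁
  rw [e₂] at c₂
  rw [e₃] at c₃
  rw [e₄] at c₄
  rw [e₅] at c₅
  rw [e₆] at c₆
  refine ⟨antiparallel_of_isCut hABC.rotate hF.rotate c₆
    (by rwa [mul_right_comm] at c₁), ?_⟩
  have hμ : 2 - lam ^ 2 * (s₁ * s₂ * s₃) ≠ 0 := by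
    intro hμ
    obtain ⟨i₁, i₄⟩ := isotropic_of_isCut hF.rotate hs₁ c₁ c₄ hμ
    obtain ⟨i₅, i₂⟩ := isotropic_of_isCut hF.rotate.rotate hs₂ c₅ c₂
      (by rw [← hμ]; ring)
    obtain ⟨i₃, i₆⟩ := isotropic_of_isCut hF hs₃ c₃ c₆ (by rw [← hμ]; ring)
    obtain ⟨P, hP, hP'⟩ := haniso
    rcases hP with rfl | rfl | rfl | rfl | rfl | rfl <;> exact hP' (by assumption)
  obtain ⟨F, hFdef⟩ : ∃ F : Fin 3 → ℝ, F = (2 - lam ^ 2 * (s₁ * s₂ * s₃))⁻¹ •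
      ((2 + lam ^ 2 * (s₁ * s₂ * s₃)) • 1 + (-2 * lam) • ![s₂ * s₃, s₁ * s₃, s₁ * s₂]) := ⟨_, rfl⟩
  obtain ⟨m, hm⟩ : ∃ m, m = vecOfDual ρ A B C F := ⟨_, rfl⟩
  have hF0 : (2 - lam ^ 2 * (s₁ * s₂ * s₃)) • F = (2 + lam ^ 2 * (s₁ * s₂ * s₃)) • 1 +
      (-2 * lam) • ![s₂ * s₃, s₁ * s₃, s₁ * s₂] := by
    rw [hFdef, smul_inv_smul₀ hμ]
  have hmA : (2 - lam ^ 2 * (s₁ * s₂ * s₃)) * form ρ m (unitVec ρ A) =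
      2 + lam ^ 2 * (s₁ * s₂ * s₃) - 2 * lam * (s₂ * s₃) := by
    have h6 := hF.form_vecOfDual F 0
    have h7 := congrFun hF0 0
    simp only [frame, Matrix.cons_val, Pi.smul_apply, Pi.add_apply, Pi.one_apply,
      smul_eq_mul] at h6 h7
    rw [hm, h6, h7]
    ring
  have hmB : (2 - lam ^ 2 * (s₁ * s₂ * s₃)) * form ρ m (unitVec ρ B) =
      2 + lam ^ 2 * (s₁ * s₂ * s₃) - 2 * lam * (s₁ * s₃) := by
    have h6 := hF.form_vecOfDual F 1
    have h7 := congrFun hF0 1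
    simp only [frame, Matrix.cons_val, Pi.smul_apply, Pi.add_apply, Pi.one_apply,
      smul_eq_mul] at h6 h7
    rw [hm, h6, h7]
    ring
  have hmC : (2 - lam ^ 2 * (s₁ * s₂ * s₃)) * form ρ m (unitVec ρ C) =
      2 + lam ^ 2 * (s₁ * s₂ * s₃) - 2 * lam * (s₁ * s₂) := by
    have h6 := hF.form_vecOfDual F 2
    have h7 := congrFun hF0 2
    simp only [frame, Matrix.cons_val, Pi.smul_apply, Pi.add_apply, Pi.one_apply,
      smul_eq_mul] at h6 h7
    rw [hm, h6, h7]
    ring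
  have H : ∀ P ∈ ({P₁, Q₂, P₃, Q₁, P₂, Q₃} : Set Plane), 0 ≤ form ρ m (lift P) ∧
      ε * form ρ (lift P) (lift P) = form ρ m (lift P) ^ 2 := by
    rintro P (rfl | rfl | rfl | rfl | rfl | rfl)
    · exact c₁.on_circle (x := s₂) hF.rotate hs₁ hμ (by linear_combination hmB)
        (by linear_combination hmC)
    · exact c₂.on_circle (x := s₁) hF.swap hs₂'
        (fun h => hμ (by rw [← h]; ring)) (by linear_combination hmA) (by linear_combination hmC)
    · exact c₃.on_circle (x := s₁) hF hs₃
        (fun h => hμ (by rw [← h]; ring)) (by linear_combination hmA) (by linear_combination hmB)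
    · exact c₄.on_circle (x := s₃) hF.rotate.rotate.swap hs₁'
        (fun h => hμ (by rw [← h]; ring)) (by linear_combination hmC) (by linear_combination hmB)
    · exact c₅.on_circle (x := s₃) hF.rotate.rotate hs₂
        (fun h => hμ (by rw [← h]; ring)) (by linear_combination hmC) (by linear_combination hmA)
    · exact c₆.on_circle (x := s₂) hF.rotate.swap hs₃'
        (fun h => hμ (by rw [← h]; ring)) (by linear_combination hmB) (by linear_combination hmA)
  obtain ⟨R, hR, hR0⟩ := haniso
  -- An anisotropic point among the six has sign `ε`, so it can normalize the center of any circle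
  -- through them.
  have hRpos : 0 < ε * form ρ (lift R) (lift R) := by
    refine lt_of_le_of_ne (by rw [(H R hR).2]; positivity) fun h0 => hR0 ?_
    have hε0 : ε ≠ 0 := left_ne_zero_of_mul (hF.sq ▸ one_ne_zero)
    rw [pointSign, ← form_lift, (mul_eq_zero.1 h0.symm).resolve_left hε0, sign_zero]
  have hm0 : m ≠ 0 := by
    rintro h0
    rw [(H R hR).2, h0, form_zero_left] at hRpos
    norm_num at hRpos
  constructor
  · have hne : P₁ ≠ Q₂ := by
      rintro rfl
      have h6 := hF.coord_eq_zero (u := -q₂') (v := p₁) (w := p₁' - q₂) (by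
        rw [ep₁, ← sub_eq_zero] at eq₂
        rw [← eq₂]
        module)
      exact np₁ h6.2.1
    refine ⟨circleMatrix ρ ε m, m, isCircle_circleMatrix hρ hF.sq hm0 (H P₁ (by simp)).2
      (H Q₂ (by simp)).2 (linearIndependent_lift hne), fun P hP => ?_, fun P hP => (H P hP).1⟩
    rw [dotProduct_circleMatrix, (H P hP).2]
    ring
  · intro M T hT hOK
    obtain ⟨r, hr, r', hr', hM⟩ := hT.circle.exists_form_eq_of_mem hρ hF.sq (hT.mem R hR) hRpos
    -- Both functionals are the nonnegative root of the same number at each of the six points.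
    have he : ∀ P ∈ ({P₁, Q₂, P₃, Q₁, P₂, Q₃} : Set Plane), form ρ (r • T - m) (lift P) = 0 := by
      intro P hP
      have h6 := hT.mem P hP
      rw [hM] at h6
      have h7 := (mul_eq_zero.1 h6).resolve_left hr'
      have h8 : 0 ≤ form ρ (r • T) (lift P) := by
        rw [form_smul_left]
        exact mul_nonneg hr.le (hT.branch P hP)
      rw [form_sub_left, sub_eq_zero, ← pow_left_inj₀ h8 (H P hP).1 two_ne_zero, ← (H P hP).2]
      linarith
    obtain ⟨hl, n₃', -⟩ := c₁.tucker_relation hF.rotate hs₁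
    obtain ⟨-, n₂', -⟩ := c₃.tucker_relation hF hs₃
    obtain ⟨-, n₁', -⟩ := c₅.tucker_relation hF.rotate.rotate hs₂
    obtain ⟨z₁, z₂, z₃⟩ := hexagon_nondegenerate hl hμ n₁' n₂' n₃'
      (c₃.form_relation hF hs₃ (he P₃ (by simp)))
      (c₆.form_relation hF.rotate.swap hs₃' (he Q₃ (by simp)))
      (c₁.form_relation hF.rotate hs₁ (he P₁ (by simp)))
      (c₄.form_relation hF.rotate.rotate.swap hs₁' (he Q₁ (by simp)))
      (c₂.form_relation hF.swap hs₂' (he Q₂ (by simp)))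
      (c₅.form_relation hF.rotate.rotate hs₂ (he P₂ (by simp)))
    have hrT : r • T - m = 0 := hF.eq_of_form_eq (by rw [z₁, form_zero_left])
      (by rw [z₂, form_zero_left]) (by rw [z₃, form_zero_left])
    rw [← Submodule.smul_mem_iff _ hr.ne', sub_eq_zero.1 hrT, hm, hFdef, vecOfDual_smul, vecOfDual_add,
      vecOfDual_smul, vecOfDual_smul, ← circumcenter_eq_vecOfDual]
    exact Submodule.smul_mem _ _ (Submodule.add_mem _
      (Submodule.smul_mem _ _ (Submodule.subset_span (by simp)))
      (Submodule.smul_mem _ _ (hF.vecOfDual_mem_span hs₁ hs₂ hs₃ hOK)))
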